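/- For $1\le p<\infty$ let $L_p(\mathbb T)$ be the complex Banach space of (classes of) $p$-integrable functions $f:\mathbb T\to\mathbb C$ on the unit circle $\mathbb T$ with normalized Lebesgue measure, and let $$H_p=H_p(\mathbb T)=\Big\{f\in L_p(\mathbb T):\ \hat f(-n)=\frac1{2\pi}\int_0^{2\pi}f(e^{i\theta})e^{in\theta}\,d\theta=0\ \text{ for all integers } n\ge 1\Big\}$$ be the Hardy space, with the norm of $L_p(\mathbb T)$. A linear subspace $Y$ of a complex normed space $X$ is called $1$-complemented in $X$ if there is a bounded linear projection $P:X\to X$ ($P^2=P$) with $\|P\|=1$ and range $P(X)=Y$. **Theorem.** Let $1\le p<\infty$ with $p\ne 2$. Then the Hardy space $H_p(\mathbb T)$ contains no $1$-complemented subspace whose dimension (over $\mathbb C$) is finite and at least $2$. -/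

import Mathlib

open MeasureTheory AddCircle
open scoped ENNReal

instance factTwoPiPos : Fact (0 < 2 * Real.pi) := ⟨Real.two_pi_pos⟩

/-- The Hardy space `H_p(𝕋)`: the subspace of the complex space `L_p(𝕋)` of all functions whose
Fourier coefficients of negative index vanish. The torus is `ℝ / 2πℤ` with normalized Haar
measure `dθ / 2π`, the point `θ` standing for `e^{iθ}`. The norm is that of `L_p(𝕋)`. -/
noncomputable def hardySpace (p : ℝ≥0∞) [Fact (1 ≤ p)] :
    Submodule ℂ (Lp ℂ p (haarAddCircle (T := 2 * Real.pi))) where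
  carrier := {f | ∀ n : ℕ, 0 < n → fourierCoeff f (-(n : ℤ)) = 0}
  zero_mem' := by
    intro n _
    rw [fourierCoeff_congr_ae (Lp.coeFn_zero ℂ p haarAddCircle)]
    simp [fourierCoeff]
  add_mem' := by
    intro f g hf hg n hn
    have hfi : Integrable f haarAddCircle := (Lp.memLp f).integrable Fact.out
    have hgi : Integrable g haarAddCircle := (Lp.memLp g).integrable Fact.out
    rw [fourierCoeff_congr_ae (Lp.coeFn_add f g), fourierCoeff.add hfi hgi]
    simp [hf n hn, hg n hn]
  smul_mem' := by
    intro c f hf n hn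
    rw [fourierCoeff_congr_ae (Lp.coeFn_smul c f)]
    have h := fourierCoeff.const_smul (f : AddCircle (2 * Real.pi) → ℂ) c (-(n : ℤ))
    exact h.trans (by rw [hf n hn, smul_zero])

/-- A subspace `Y` of a complex normed space `X` is `1`-complemented if it is the range of a
bounded linear projection of `X` of norm one. -/
def IsOneComplemented {X : Type*} [NormedAddCommGroup X] [NormedSpace ℂ X]
    (Y : Submodule ℂ X) : Prop :=
  ∃ P : X →L[ℂ] X, (∀ x, P (P x) = P x) ∧ ‖P‖ = 1 ∧ LinearMap.range (P : X →ₗ[ℂ] X) = Y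

/-! ### Analytic functions on the circle: mean values, a Jensen-type inequality, nonvanishing. -/

section FourierAnalysis

open Filter Topology ComplexConjugate

variable {T : ℝ}

/-! Let `P` be a contractive projection of `H_p` with finite-dimensional range `Y`. For `f` in `Y`
and `g` in the kernel, `‖f‖ ≤ ‖f + c g‖` for all scalars `c`, and differentiating the `p`-th power
of the norm gives `∫ |f|^(p-2) conj f · g = 0` (`integral_norm_rpow_mul_conj_mul_eq_zero`). This
uses that a nonzero analytic function is nonzero almost everywhere (`IsAnalyticL1.ae_ne_zero`),
which matters most when `p` is near `1`.

The relation is nonlinear in `f`. Averaging it over all combinations `∑ t i * f i` of a spanning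
family of `Y`, against a unitarily invariant measure in `t`, makes it sesquilinear: the single
weight `w = (∑ |f i|^2)^((p-2)/2)` makes `Y` and the kernel orthogonal
(`isOrthogonalityWeight_norm_conjTuple`).

Such a weight is unique up to a factor (`IsOrthogonalityWeight.ae_eq_const_mul`). Given two, the
Hermitian forms they define on `Y` have a common eigenvector `g`, so `∫ (w' - r w) conj g · k = 0`
for every `k` in `H_p`. Taking `k = e^{inθ} g` with `n ≥ 0`, the real function `(w' - r w)|g|^2` has
enough vanishing Fourier coefficients to be zero.

Now compare the weight of a basis with that of the basis enlarged by some `g` in `Y`. As `p ≠ 2`,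
the sums `S` and `S + |g|^2` are proportional, so every `|g|^2` is a constant multiple of `S`. By
polarization, so is `f conj g` for `f`, `g` in `Y`; hence `f` is a multiple of any nonzero `g`, and
`Y` has dimension at most one. -/

theorem fourier_one_pow (n : ℕ) (x : AddCircle T) : fourier 1 x ^ n = fourier (n : ℤ) x := by
  induction n with
  | zero => simp
  | succ n ih => rw [pow_succ, ih, Nat.cast_succ, fourier_add]

variable [Fact (0 < T)]

theorem integrable_continuousMap_mul {f : AddCircle T → ℂ} (hf : Integrable f haarAddCircle)
    (k : C(AddCircle T, ℂ)) : Integrable (fun x => k x * f x) haarAddCircle :=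
  hf.bdd_mul (c := ‖k‖) k.continuous.aestronglyMeasurable (ae_of_all _ k.norm_coe_le_norm)

/-- Integration against an integrable function, as a functional on continuous functions. -/
noncomputable def integralMulCLM {f : AddCircle T → ℂ} (hf : Integrable f haarAddCircle) :
    C(AddCircle T, ℂ) →L[ℂ] ℂ :=
  LinearMap.mkContinuous
    { toFun := fun k => ∫ x, k x * f x ∂haarAddCircle
      map_add' := fun k l => by
        simp only [ContinuousMap.add_apply, add_mul]
        exact integral_add (integrable_continuousMap_mul hf k) (integrable_continuousMap_mul hf l)
      map_smul' := fun c k => by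
        simp only [ContinuousMap.smul_apply, smul_eq_mul, mul_assoc, RingHom.id_apply]
        exact integral_const_mul _ _ }
    (∫ x, ‖f x‖ ∂haarAddCircle) fun k => by
      rw [mul_comm, ← integral_const_mul]
      refine norm_integral_le_of_norm_le (hf.norm.const_mul _) (ae_of_all _ fun x => ?_)
      rw [norm_mul]
      gcongr
      exact k.norm_coe_le_norm x

theorem integral_continuousMap_mul_eq_zero {f : AddCircle T → ℂ}
    (hf : Integrable f haarAddCircle)
    (h : ∀ n : ℤ, ∫ x, fourier n x * f x ∂haarAddCircle = 0) (k : C(AddCircle T, ℂ)) :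
    ∫ x, k x * f x ∂haarAddCircle = 0 := by
  have hk : k ∈ (Submodule.span ℂ (Set.range (fourier (T := T)))).topologicalClosure := by
    rw [span_fourier_closure_eq_top]; trivial
  have hle : (Submodule.span ℂ (Set.range (fourier (T := T)))).topologicalClosure
      ≤ LinearMap.ker (integralMulCLM hf : C(AddCircle T, ℂ) →ₗ[ℂ] ℂ) := by
    refine Submodule.topologicalClosure_minimal _ ?_ (integralMulCLM hf).isClosed_ker
    rw [Submodule.span_le]
    rintro _ ⟨n, rfl⟩
    exact h n
  exact hle hk

theorem ae_eq_zero_of_integral_fourier_mul_eq_zero {f : AddCircle T → ℂ}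
    (hf : Integrable f haarAddCircle)
    (h : ∀ n : ℤ, ∫ x, fourier n x * f x ∂haarAddCircle = 0) :
    f =ᵐ[haarAddCircle] 0 := by
  refine ae_eq_zero_of_forall_setIntegral_isClosed_eq_zero hf fun s hs => ?_
  have hlim : Tendsto (fun n => ∫ x, ((hs.apprSeq n x : ℝ) : ℂ) * f x ∂haarAddCircle) atTop
      (𝓝 (∫ x, s.indicator f x ∂haarAddCircle)) := by
    refine tendsto_integral_of_dominated_convergence (fun x => ‖f x‖) (fun n => ?_) hf.norm
      (fun n => ae_of_all _ fun x => ?_) (ae_of_all _ fun x => ?_)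
    · exact (Complex.continuous_ofReal.comp (NNReal.continuous_coe.comp
        (hs.apprSeq n).continuous)).aestronglyMeasurable.mul hf.1
    · rw [norm_mul]
      refine mul_le_of_le_one_left (norm_nonneg _) ?_
      simpa using HasOuterApproxClosed.apprSeq_apply_le_one hs n x
    · have h1 := tendsto_pi_nhds.1 (HasOuterApproxClosed.tendsto_apprSeq hs) x
      have h2 := ((Complex.continuous_ofReal.comp NNReal.continuous_coe).tendsto _).comp h1
      have h3 := h2.mul_const (f x)
      refine h3.congr' (Eventually.of_forall fun n => rfl) |>.trans ?_
      by_cases hx : x ∈ s <;> simp [hx]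
  rw [← integral_indicator hs.measurableSet]
  refine tendsto_nhds_unique hlim (tendsto_const_nhds.congr fun n => ?_)
  exact (integral_continuousMap_mul_eq_zero hf h ⟨fun x => ((hs.apprSeq n x : ℝ) : ℂ),
    Complex.continuous_ofReal.comp (NNReal.continuous_coe.comp (hs.apprSeq n).continuous)⟩).symm

/-- An integrable function is analytic if its Fourier coefficients of negative index vanish. -/
def IsAnalyticL1 (f : AddCircle T → ℂ) : Prop :=
  Integrable f haarAddCircle ∧
    ∀ n : ℕ, 0 < n → ∫ x, fourier (n : ℤ) x * f x ∂haarAddCircle = 0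

/-- Only the constant term of `Q` survives integration against an analytic function. This replaces
evaluation at the centre of the disc. -/
theorem IsAnalyticL1.integral_eval_mul {f : AddCircle T → ℂ} (hf : IsAnalyticL1 f)
    (Q : Polynomial ℂ) :
    ∫ x, Q.eval (fourier 1 x) * f x ∂haarAddCircle
      = Q.eval 0 * ∫ x, f x ∂haarAddCircle := by
  have hint : ∀ Q : Polynomial ℂ, Integrable (fun x => Q.eval (fourier 1 x) * f x)
      haarAddCircle := fun Q => integrable_continuousMap_mul hf.1
        ⟨fun x => Q.eval (fourier 1 x), Q.continuous.comp (fourier 1).continuous⟩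
  induction Q using Polynomial.induction_on' with
  | add P Q hP hQ =>
    simp only [Polynomial.eval_add, add_mul]
    rw [integral_add (hint P) (hint Q), hP, hQ]
  | monomial n a =>
    simp only [Polynomial.eval_monomial, fourier_one_pow, mul_assoc, integral_const_mul]
    rcases Nat.eq_zero_or_pos n with rfl | hn
    · simp
    · rw [hf.2 n hn]; simp [hn.ne']

theorem IsAnalyticL1.integral_exp_mul {f : AddCircle T → ℂ} (hf : IsAnalyticL1 f)
    (Q : Polynomial ℂ) :
    ∫ x, Complex.exp (Q.eval (fourier 1 x)) * f x ∂haarAddCircle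
      = Complex.exp (Q.eval 0) * ∫ x, f x ∂haarAddCircle := by
  let q : C(AddCircle T, ℂ) := ⟨fun x => Q.eval (fourier 1 x),
    Q.continuous.comp (fourier 1).continuous⟩
  have hexp : ∀ z : ℂ, HasSum (fun n : ℕ => z ^ n / (n.factorial : ℂ)) (Complex.exp z) := by
    intro z
    rw [Complex.exp_eq_exp_ℂ]
    exact NormedSpace.expSeries_div_hasSum_exp z
  have h1 : HasSum (fun n : ℕ => ∫ x, (q x ^ n / (n.factorial : ℂ)) * f x ∂haarAddCircle)
      (∫ x, Complex.exp (q x) * f x ∂haarAddCircle) := by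
    refine hasSum_integral_of_dominated_convergence
      (fun n x => ‖q‖ ^ n / (n.factorial : ℝ) * ‖f x‖) (fun n => ?_) (fun n => ?_) ?_ ?_ ?_
    · exact ((q.continuous.pow n).div_const _).aestronglyMeasurable.mul hf.1.1
    · refine ae_of_all _ fun x => ?_
      rw [norm_mul, norm_div, norm_pow, Complex.norm_natCast]
      gcongr
      exact q.norm_coe_le_norm x
    · exact ae_of_all _ fun x => (Real.summable_pow_div_factorial _).mul_right _
    · simp only [tsum_mul_right]
      exact hf.1.norm.const_mul _
    · exact ae_of_all _ fun x => (hexp _).mul_right _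
  have h2 : ∀ n : ℕ, ∫ x, (q x ^ n / (n.factorial : ℂ)) * f x ∂haarAddCircle
      = Q.eval 0 ^ n / (n.factorial : ℂ) * ∫ x, f x ∂haarAddCircle := by
    intro n
    have := hf.integral_eval_mul (Polynomial.C ((n.factorial : ℂ)⁻¹) * Q ^ n)
    simpa [q, div_eq_inv_mul] using this
  simp only [h2] at h1
  exact h1.unique ((hexp _).mul_right _)

/-- A form of Jensen's inequality: `f · exp Q` has mean `exp (Q 0)` times that of `f`, `|exp Q| =
exp (Re Q)`, and the mean of `Re Q` is `Re (Q 0)`. -/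
theorem IsAnalyticL1.norm_integral_mul_exp_le_polynomial {f : AddCircle T → ℂ}
    (hf : IsAnalyticL1 f) (Q : Polynomial ℂ) :
    ‖∫ x, f x ∂haarAddCircle‖ * Real.exp (∫ x, (Q.eval (fourier 1 x)).re ∂(haarAddCircle (T := T)))
      ≤ ∫ x, Real.exp (Q.eval (fourier 1 x)).re * ‖f x‖ ∂haarAddCircle := by
  have hq : Continuous fun x : AddCircle T => Q.eval (fourier 1 x) :=
    Q.continuous.comp (fourier 1).continuous
  have hone : IsAnalyticL1 (fun _ : AddCircle T => (1 : ℂ)) := by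
    refine ⟨integrable_const _, fun n hn => ?_⟩
    have h0 := fourierCoeff_fourier (T := T) 0
    have := congrFun h0 (-(n : ℤ))
    simpa [fourierCoeff, hn.ne'] using this
  have hmean : ∫ x, (Q.eval (fourier 1 x)).re ∂(haarAddCircle (T := T)) = (Q.eval 0).re := by
    have h := hone.integral_eval_mul Q
    simp only [mul_one, integral_const, probReal_univ, one_smul] at h
    have hi : Integrable (fun x : AddCircle T => Q.eval (fourier 1 x)) haarAddCircle := by
      simpa using integrable_continuousMap_mul hone.1 ⟨_, hq⟩
    rw [← h]
    exact integral_re hi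
  rw [hmean, ← Complex.norm_exp, mul_comm, ← norm_mul, ← hf.integral_exp_mul]
  refine (norm_integral_le_integral_norm _).trans_eq ?_
  simp only [norm_mul, Complex.norm_exp]

/-- Trigonometric polynomials are dense and have the form `P + conj Q` with `P`, `Q` analytic
polynomials; the real part is that of `P + Q`. -/
theorem exists_polynomial_re_near (u : C(AddCircle T, ℝ)) {ε : ℝ} (hε : 0 < ε) :
    ∃ Q : Polynomial ℂ, ∀ x, |u x - (Q.eval (fourier 1 x)).re| ≤ ε := by
  let U : C(AddCircle T, ℂ) := ⟨fun x => (u x : ℂ), Complex.continuous_ofReal.comp u.continuous⟩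
  have hU : U ∈ (Submodule.span ℂ (Set.range (fourier (T := T)))).topologicalClosure := by
    rw [span_fourier_closure_eq_top]; trivial
  obtain ⟨k, hk, hdist⟩ := Metric.mem_closure_iff.1 hU ε hε
  have hrep : ∃ P Q : Polynomial ℂ,
      ∀ x, k x = P.eval (fourier 1 x) + conj (Q.eval (fourier 1 x)) := by
    refine Submodule.span_induction (p := fun k _ => ∃ P Q : Polynomial ℂ,
      ∀ x, k x = P.eval (fourier 1 x) + conj (Q.eval (fourier 1 x))) ?_ ?_ ?_ ?_ hk
    · rintro _ ⟨n, rfl⟩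
      rcases Int.eq_nat_or_neg n with ⟨m, rfl | rfl⟩
      · exact ⟨Polynomial.X ^ m, 0, fun x => by
          rw [Polynomial.eval_pow, Polynomial.eval_X, fourier_one_pow, Polynomial.eval_zero,
            map_zero, add_zero]⟩
      · exact ⟨0, Polynomial.X ^ m, fun x => by
          rw [Polynomial.eval_pow, Polynomial.eval_X, fourier_one_pow, Polynomial.eval_zero,
            fourier_neg, zero_add]⟩
    · exact ⟨0, 0, fun x => by simp⟩
    · rintro k l _ _ ⟨P, Q, h⟩ ⟨P', Q', h'⟩
      exact ⟨P + P', Q + Q', fun x => by simp [h, h']; ring⟩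
    · rintro c k _ ⟨P, Q, h⟩
      exact ⟨Polynomial.C c * P, Polynomial.C (conj c) * Q, fun x => by simp [h]; ring⟩
  obtain ⟨P, Q, hPQ⟩ := hrep
  refine ⟨P + Q, fun x => ?_⟩
  have h1 : ‖(U - k) x‖ ≤ ε :=
    ((U - k).norm_coe_le_norm x).trans (by rw [← dist_eq_norm]; exact hdist.le)
  refine le_trans ?_ h1
  have h2 : u x - ((P + Q).eval (fourier 1 x)).re = ((U - k) x).re := by
    simp [U, hPQ]
  rw [h2]
  exact Complex.abs_re_le_norm _

theorem IsAnalyticL1.norm_integral_mul_exp_le {f : AddCircle T → ℂ}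
    (hf : IsAnalyticL1 f) (u : C(AddCircle T, ℝ)) :
    ‖∫ x, f x ∂haarAddCircle‖ * Real.exp (∫ x, u x ∂(haarAddCircle (T := T)))
      ≤ ∫ x, Real.exp (u x) * ‖f x‖ ∂haarAddCircle := by
  have hint : ∀ v : AddCircle T → ℝ, Continuous v →
      Integrable (fun x => Real.exp (v x) * ‖f x‖) haarAddCircle := by
    intro v hv
    have := (integrable_continuousMap_mul hf.1 ⟨fun x => ((Real.exp (v x) : ℝ) : ℂ),
      Complex.continuous_ofReal.comp (Real.continuous_exp.comp hv)⟩).norm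
    refine this.congr (ae_of_all _ fun x => ?_)
    simp [Complex.norm_exp]
  have key : ∀ ε : ℝ, 0 < ε →
      ‖∫ x, f x ∂haarAddCircle‖ * Real.exp (∫ x, u x ∂(haarAddCircle (T := T)))
        ≤ Real.exp (2 * ε) * ∫ x, Real.exp (u x) * ‖f x‖ ∂haarAddCircle := by
    intro ε hε
    obtain ⟨Q, hQ⟩ := exists_polynomial_re_near u hε
    have hq : Continuous fun x : AddCircle T => (Q.eval (fourier 1 x)).re :=
      Complex.continuous_re.comp (Q.continuous.comp (fourier 1).continuous)
    have hi : ∀ v : AddCircle T → ℝ, Continuous v → Integrable v haarAddCircle := fun v hv =>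
      hv.integrable_of_hasCompactSupport (HasCompactSupport.of_compactSpace _)
    have h1 : ∫ x, u x ∂(haarAddCircle (T := T))
        ≤ ε + ∫ x, (Q.eval (fourier 1 x)).re ∂(haarAddCircle (T := T)) := by
      have : ∫ x, u x ∂(haarAddCircle (T := T))
          ≤ ∫ x, (ε + (Q.eval (fourier 1 x)).re) ∂(haarAddCircle (T := T)) :=
        integral_mono (hi _ u.continuous) (hi _ (continuous_const.add hq))
          fun x => by linarith [(abs_le.1 (hQ x)).2]
      rwa [integral_add (integrable_const _) (hi _ hq), integral_const, probReal_univ,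
        one_smul] at this
    calc _ ≤ ‖∫ x, f x ∂haarAddCircle‖ * (Real.exp ε *
            Real.exp (∫ x, (Q.eval (fourier 1 x)).re ∂(haarAddCircle (T := T)))) := by
          rw [← Real.exp_add]; gcongr
      _ = Real.exp ε * (‖∫ x, f x ∂haarAddCircle‖ *
            Real.exp (∫ x, (Q.eval (fourier 1 x)).re ∂(haarAddCircle (T := T)))) := by ring
      _ ≤ Real.exp ε * ∫ x, Real.exp (Q.eval (fourier 1 x)).re * ‖f x‖ ∂haarAddCircle := by
          gcongr; exact hf.norm_integral_mul_exp_le_polynomial Q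
      _ ≤ Real.exp ε * ∫ x, Real.exp ε * (Real.exp (u x) * ‖f x‖) ∂haarAddCircle := by
          refine mul_le_mul_of_nonneg_left (integral_mono (hint _ hq)
            ((hint _ u.continuous).const_mul _) fun x => ?_) (Real.exp_nonneg _)
          simp only
          rw [← mul_assoc, ← Real.exp_add]
          gcongr
          linarith [(abs_le.1 (hQ x)).1]
      _ = _ := by rw [integral_const_mul, ← mul_assoc, ← Real.exp_add, two_mul]
  have hlim : Tendsto (fun ε : ℝ => Real.exp (2 * ε) *
      ∫ x, Real.exp (u x) * ‖f x‖ ∂haarAddCircle) (𝓝[>] 0)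
      (𝓝 (Real.exp (2 * 0) * ∫ x, Real.exp (u x) * ‖f x‖ ∂haarAddCircle)) :=
    (Continuous.tendsto (by fun_prop) 0).mono_left nhdsWithin_le_nhds
  simp only [mul_zero, Real.exp_zero, one_mul] at hlim
  exact ge_of_tendsto hlim (eventually_mem_nhdsWithin.mono fun ε hε => key ε hε)

/-- Take `u` close to `c` times the indicator of `K` in `IsAnalyticL1.norm_integral_mul_exp_le`. In
the limit the right side is `∫ ‖f‖`, since `f` vanishes on `K`, while the left side contains `exp (c
|K|)`; letting `c` grow forces the mean to vanish. -/
theorem IsAnalyticL1.integral_eq_zero {f : AddCircle T → ℂ} (hf : IsAnalyticL1 f)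
    {K : Set (AddCircle T)} (hK : IsClosed K) (hK0 : haarAddCircle K ≠ 0)
    (hfK : ∀ x ∈ K, f x = 0) : ∫ x, f x ∂haarAddCircle = 0 := by
  have hpos : 0 < haarAddCircle.real K := ENNReal.toReal_pos hK0 (measure_ne_top _ _)
  have key : ∀ c : ℝ, 0 ≤ c → ‖∫ x, f x ∂haarAddCircle‖ * Real.exp (c * haarAddCircle.real K)
      ≤ ∫ x, ‖f x‖ ∂haarAddCircle := by
    intro c hc
    have hcont : ∀ n, Continuous fun x => c * (hK.apprSeq n x : ℝ) := fun n =>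
      continuous_const.mul (NNReal.continuous_coe.comp (hK.apprSeq n).continuous)
    have hle : ∀ n x, c * (hK.apprSeq n x : ℝ) ≤ c := fun n x =>
      mul_le_of_le_one_right hc (by exact_mod_cast HasOuterApproxClosed.apprSeq_apply_le_one hK n x)
    have hptw : ∀ x, Tendsto (fun n => c * (hK.apprSeq n x : ℝ)) atTop
        (𝓝 (K.indicator (fun _ => c) x)) := by
      intro x
      have h1 := tendsto_pi_nhds.1 (HasOuterApproxClosed.tendsto_apprSeq hK) x
      have h2 := ((NNReal.continuous_coe.tendsto _).comp h1).const_mul c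
      refine h2.congr' (Eventually.of_forall fun n => rfl) |>.trans ?_
      by_cases hx : x ∈ K <;> simp [hx]
    have hlim1 : Tendsto (fun n => ∫ x, c * (hK.apprSeq n x : ℝ) ∂haarAddCircle) atTop
        (𝓝 (c * haarAddCircle.real K)) := by
      have := tendsto_integral_of_dominated_convergence (μ := haarAddCircle (T := T)) (fun _ => c)
        (fun n => (hcont n).aestronglyMeasurable) (integrable_const _)
        (fun n => ae_of_all _ fun x => by
          rw [Real.norm_of_nonneg (by positivity)]; exact hle n x)
        (ae_of_all _ hptw)
      rwa [integral_indicator hK.measurableSet, setIntegral_const, smul_eq_mul, mul_comm] at this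
    have hlim2 : Tendsto (fun n => ∫ x, Real.exp (c * (hK.apprSeq n x : ℝ)) * ‖f x‖ ∂haarAddCircle)
        atTop (𝓝 (∫ x, ‖f x‖ ∂haarAddCircle)) := by
      refine tendsto_integral_of_dominated_convergence (fun x => Real.exp c * ‖f x‖)
        (fun n => (Real.continuous_exp.comp (hcont n)).aestronglyMeasurable.mul hf.1.1.norm)
        (hf.1.norm.const_mul _) (fun n => ae_of_all _ fun x => ?_) (ae_of_all _ fun x => ?_)
      · rw [Real.norm_of_nonneg (by positivity)]
        gcongr
        exact hle n x
      · have h := ((Real.continuous_exp.tendsto _).comp (hptw x)).mul_const ‖f x‖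
        by_cases hx : x ∈ K
        · simp [hfK x hx]
        · simpa [hx, Function.comp_def] using h
    exact le_of_tendsto_of_tendsto' ((((Real.continuous_exp.tendsto _).comp hlim1)).const_mul _)
      hlim2 fun n => hf.norm_integral_mul_exp_le ⟨_, hcont n⟩
  by_contra hne
  have hn : 0 < ‖∫ x, f x ∂haarAddCircle‖ := norm_pos_iff.2 hne
  have htop : Tendsto (fun c : ℝ => ‖∫ x, f x ∂haarAddCircle‖ *
      Real.exp (c * haarAddCircle.real K)) atTop atTop :=
    (Real.tendsto_exp_atTop.comp (tendsto_id.atTop_mul_const hpos)).const_mul_atTop hn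
  obtain ⟨c, hc0, hc⟩ := ((eventually_ge_atTop (0 : ℝ)).and
    (htop.eventually_gt_atTop (∫ x, ‖f x‖ ∂haarAddCircle))).exists
  exact (key c hc0).not_gt hc

/-- An analytic function vanishing on a set of positive measure is zero. -/
theorem IsAnalyticL1.ae_eq_zero {f : AddCircle T → ℂ} (hf : IsAnalyticL1 f)
    {K : Set (AddCircle T)} (hK : IsClosed K) (hK0 : haarAddCircle K ≠ 0)
    (hfK : ∀ x ∈ K, f x = 0) : f =ᵐ[haarAddCircle] 0 := by
  have hint : ∀ n : ℤ, Integrable (fun x => fourier n x * f x) haarAddCircle :=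
    fun n => integrable_continuousMap_mul hf.1 _
  have hcoef : ∀ m : ℕ, ∫ x, fourier (-(m : ℤ)) x * f x ∂haarAddCircle = 0 := by
    intro m
    induction m using Nat.strong_induction_on with
    | _ m ih =>
      -- Once the coefficients of index below `m` vanish, `e^{-imθ} f` is again analytic and zero on
      -- `K`, so its mean, the `m`-th coefficient of `f`, vanishes too.
      refine IsAnalyticL1.integral_eq_zero ⟨hint _, fun n hn => ?_⟩ hK hK0
        fun x hx => by rw [hfK x hx, mul_zero]
      simp only [← mul_assoc, ← fourier_add]
      rcases le_or_gt n m with hnm | hnm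
      · have h : (n : ℤ) + -(m : ℤ) = -((m - n : ℕ) : ℤ) := by omega
        rw [h]
        exact ih _ (by omega)
      · have h : (n : ℤ) + -(m : ℤ) = ((n - m : ℕ) : ℤ) := by omega
        rw [h]
        exact hf.2 _ (by omega)
  refine ae_eq_zero_of_integral_fourier_mul_eq_zero hf.1 fun n => ?_
  rcases Int.eq_nat_or_neg n with ⟨m, rfl | rfl⟩
  · rcases Nat.eq_zero_or_pos m with rfl | hm
    · simpa using hcoef 0
    · exact hf.2 m hm
  · exact hcoef m

/-- A nonzero analytic function vanishes almost nowhere. -/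
theorem IsAnalyticL1.ae_ne_zero {f : AddCircle T → ℂ} (hf : IsAnalyticL1 f)
    (hmeas : Measurable f) (hne : ¬ f =ᵐ[haarAddCircle] 0) :
    ∀ᵐ x ∂haarAddCircle, f x ≠ 0 := by
  by_contra h
  have hm : MeasurableSet {x | f x = 0} := hmeas (measurableSet_singleton 0)
  have hpos : 0 < haarAddCircle {x | f x = 0} := by
    rw [pos_iff_ne_zero]
    intro h0
    exact h (by rw [ae_iff]; simpa using h0)
  obtain ⟨K, hKs, hK, hK0⟩ := hm.exists_lt_isClosed_of_ne_top (measure_ne_top _ _) hpos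
  exact hne (hf.ae_eq_zero hK hK0.ne' fun x hx => hKs hx)

/-- A real function with vanishing Fourier coefficients of nonpositive index is zero. -/
theorem ae_eq_zero_of_integral_fourier_mul_ofReal {u : AddCircle T → ℝ}
    (hu : Integrable u haarAddCircle)
    (h : ∀ n : ℕ, ∫ x, fourier (n : ℤ) x * (u x : ℂ) ∂haarAddCircle = 0) :
    u =ᵐ[haarAddCircle] 0 := by
  have h' : (fun x => (u x : ℂ)) =ᵐ[haarAddCircle] 0 := by
    refine ae_eq_zero_of_integral_fourier_mul_eq_zero hu.ofReal fun n => ?_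
    rcases Int.eq_nat_or_neg n with ⟨m, rfl | rfl⟩
    · exact h m
    · have := congrArg conj (h m)
      rw [← integral_conj] at this
      simpa only [fourier_neg, map_mul, map_zero, Complex.conj_ofReal] using this
  filter_upwards [h'] with x hx
  exact Complex.ofReal_eq_zero.1 hx

end FourierAnalysis

/-! ### Variational characterization of norm minimality in `L_p`. -/

section NormMinimality

open Filter Topology ComplexConjugate

theorem hasDerivAt_norm_add_mul_rpow {a b : ℂ} (ha : a ≠ 0) (q : ℝ) :
    HasDerivAt (fun t : ℝ => ‖a + t * b‖ ^ q) (q * (‖a‖ ^ (q - 2) * (conj a * b).re)) 0 := by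
  have h1 : HasDerivAt (fun t : ℝ => a + t * b) b 0 := by
    have := ((Complex.ofRealCLM.hasDerivAt (x := (0 : ℝ))).mul_const b).const_add a
    simpa using this
  have h2 : HasDerivAt (fun t : ℝ => ‖a + t * b‖ ^ 2) (2 * (conj a * b).re) 0 := by
    have := h1.norm_sq
    refine this.congr_deriv ?_
    simp [Complex.inner, mul_comm]
  have hna : ‖a‖ ≠ 0 := norm_ne_zero_iff.2 ha
  have h3 := h2.rpow_const (p := q / 2) (Or.inl (by simpa using hna))
  have hfun : (fun t : ℝ => ‖a + t * b‖ ^ q) = fun t : ℝ => (‖a + t * b‖ ^ 2) ^ (q / 2) := by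
    funext t
    rw [← Real.rpow_natCast_mul (norm_nonneg _)]
    congr 1; push_cast; ring
  rw [hfun]
  refine h3.congr_deriv ?_
  have : (‖a‖ ^ 2) ^ (q / 2 - 1) = ‖a‖ ^ (q - 2) := by
    rw [← Real.rpow_natCast_mul (norm_nonneg _)]
    congr 1; push_cast; ring
  simp only [Complex.ofReal_zero, zero_mul, add_zero, this]
  ring

/-- Gives the integrable majorant for differentiating under the integral at `t = 0`: on `[-1, 1]`
the norm is at most `M` and is Lipschitz with constant `‖b‖ ≤ M`, and `x ^ q` has derivative at most
`q M^(q-1)` on `[0, M]`. -/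
theorem lipschitzOnWith_norm_add_mul_rpow (a b : ℂ) {q : ℝ} (hq : 1 ≤ q) :
    LipschitzOnWith (Real.nnabs (q * (‖a‖ + ‖b‖) ^ q)) (fun t : ℝ => ‖a + t * b‖ ^ q)
      (Set.Icc (-1) 1) := by
  set M := ‖a‖ + ‖b‖ with hM
  have hM0 : 0 ≤ M := by positivity
  refine LipschitzOnWith.of_dist_le_mul fun s hs t ht => ?_
  have hbd : ∀ t ∈ Set.Icc (-1 : ℝ) 1, ‖a + t * b‖ ∈ Set.Icc 0 M := by
    intro t ht
    refine ⟨norm_nonneg _, (norm_add_le _ _).trans ?_⟩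
    rw [norm_mul, Complex.norm_real, hM]
    gcongr
    exact mul_le_of_le_one_left (norm_nonneg _) (abs_le.2 ht)
  have hmv : ‖‖a + s * b‖ ^ q - ‖a + t * b‖ ^ q‖
      ≤ (q * M ^ (q - 1)) * ‖‖a + s * b‖ - ‖a + t * b‖‖ := by
    refine Convex.norm_image_sub_le_of_norm_hasDerivWithin_le
      (f := fun x : ℝ => x ^ q) (f' := fun x : ℝ => q * x ^ (q - 1))
      (fun x _ => (Real.hasDerivAt_rpow_const (Or.inr hq)).hasDerivWithinAt)
      (fun x hx => ?_) (convex_Icc 0 M) (hbd t ht) (hbd s hs)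
    rw [Real.norm_of_nonneg (by have := hx.1; positivity)]
    exact mul_le_mul_of_nonneg_left (Real.rpow_le_rpow hx.1 hx.2 (by linarith)) (by linarith)
  rw [Real.dist_eq, ← Real.norm_eq_abs, Real.coe_nnabs,
    abs_of_nonneg (mul_nonneg (by linarith) (by positivity))]
  refine hmv.trans ?_
  have h1 : ‖‖a + s * b‖ - ‖a + t * b‖‖ ≤ M * dist s t := by
    refine (abs_norm_sub_norm_le _ _).trans ?_
    have : a + s * b - (a + t * b) = ((s - t : ℝ) : ℂ) * b := by push_cast; ring
    rw [this, norm_mul, Complex.norm_real, mul_comm, ← dist_eq_norm]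
    gcongr
    simp [hM]
  calc q * M ^ (q - 1) * ‖‖a + s * b‖ - ‖a + t * b‖‖
      ≤ q * M ^ (q - 1) * (M * dist s t) := by gcongr
    _ = q * (M ^ (q - 1) * M) * dist s t := by ring
    _ = q * M ^ q * dist s t := by
        rcases hM0.eq_or_lt with h0 | h0
        · rw [← h0, mul_zero, Real.zero_rpow (by linarith)]
        · rw [← Real.rpow_add_one h0.ne', sub_add_cancel]

variable {α : Type*} [MeasurableSpace α] {μ : Measure α}

theorem integrable_norm_add_norm_rpow {p : ℝ≥0∞} (hp0 : p ≠ 0) (hp : p ≠ ∞) {f g : α → ℂ}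
    (hf : MemLp f p μ) (hg : MemLp g p μ) :
    Integrable (fun x => (‖f x‖ + ‖g x‖) ^ p.toReal) μ := by
  refine ((hf.norm.add hg.norm).integrable_norm_rpow hp0 hp).congr (ae_of_all _ fun x => ?_)
  simp only [Pi.add_apply]
  rw [Real.norm_of_nonneg (by positivity)]

/-- Keeps the integrands integrable also for `q < 2`, where the weight `‖a‖ ^ (q - 2)` alone is
singular. At `a = 0` the factor `conj a` makes the value of the power irrelevant. -/
theorem norm_rpow_mul_conj_mul_le (a b : ℂ) {q : ℝ} (hq : 1 ≤ q) :
    ‖((‖a‖ ^ (q - 2) : ℝ) : ℂ) * (conj a * b)‖ ≤ (‖a‖ + ‖b‖) ^ q := by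
  rcases eq_or_ne a 0 with rfl | ha
  · simp only [map_zero, zero_mul, mul_zero, norm_zero]; positivity
  · have ha' : 0 < ‖a‖ := norm_pos_iff.2 ha
    rw [norm_mul, norm_mul, Complex.norm_real, Real.norm_of_nonneg (by positivity),
      RCLike.norm_conj, ← mul_assoc, ← Real.rpow_add_one ha'.ne']
    have hb : 0 < ‖a‖ + ‖b‖ := by positivity
    have : (‖a‖ + ‖b‖) ^ q = (‖a‖ + ‖b‖) ^ (q - 2 + 1) * (‖a‖ + ‖b‖) := by
      rw [← Real.rpow_add_one hb.ne']; congr 1; ring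
    rw [this]
    gcongr
    · linarith
    · simp
    · simp

theorem integrable_norm_rpow_mul_conj_mul {p : ℝ≥0∞} (hp1 : 1 ≤ p) (hp : p ≠ ∞) {f g : α → ℂ}
    (hf : MemLp f p μ) (hg : MemLp g p μ) :
    Integrable (fun x => ((‖f x‖ ^ (p.toReal - 2) : ℝ) : ℂ) * (conj (f x) * g x)) μ := by
  have hq : 1 ≤ p.toReal := by
    simpa using ENNReal.toReal_mono hp hp1
  refine (integrable_norm_add_norm_rpow (by positivity) hp hf hg).mono' ?_
    (ae_of_all _ fun x => norm_rpow_mul_conj_mul_le _ _ hq)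
  refine AEStronglyMeasurable.mul ?_ ((Complex.continuous_conj.comp_aestronglyMeasurable hf.1).mul hg.1)
  exact Complex.continuous_ofReal.comp_aestronglyMeasurable
    (hf.1.norm.aemeasurable.pow_const _).aestronglyMeasurable

theorem re_integral_eq_zero_of_norm_minimal {p : ℝ≥0∞} (hp1 : 1 ≤ p) (hp : p ≠ ∞) {f g : α → ℂ}
    (hf : MemLp f p μ) (hg : MemLp g p μ) (hf0 : ∀ᵐ x ∂μ, f x ≠ 0)
    (hmin : ∀ t : ℝ, ∫ x, ‖f x‖ ^ p.toReal ∂μ ≤ ∫ x, ‖f x + t * g x‖ ^ p.toReal ∂μ) :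
    (∫ x, ((‖f x‖ ^ (p.toReal - 2) : ℝ) : ℂ) * (conj (f x) * g x) ∂μ).re = 0 := by
  have hq : 1 ≤ p.toReal := by simpa using ENNReal.toReal_mono hp hp1
  have hp0 : p ≠ 0 := by positivity
  have hint := integrable_norm_rpow_mul_conj_mul hp1 hp hf hg
  have hre : ∀ x, (((‖f x‖ ^ (p.toReal - 2) : ℝ) : ℂ) * (conj (f x) * g x)).re
      = ‖f x‖ ^ (p.toReal - 2) * (conj (f x) * g x).re := fun x => by
    rw [Complex.re_ofReal_mul]
  have hd := hasDerivAt_integral_of_dominated_loc_of_lip (μ := μ) (x₀ := (0 : ℝ))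
    (F := fun (t : ℝ) x => ‖f x + t * g x‖ ^ p.toReal)
    (F' := fun x => p.toReal * (‖f x‖ ^ (p.toReal - 2) * (conj (f x) * g x).re))
    (bound := fun x => p.toReal * (‖f x‖ + ‖g x‖) ^ p.toReal)
    (Icc_mem_nhds (by norm_num) (by norm_num) : Set.Icc (-1 : ℝ) 1 ∈ 𝓝 0)
    (Eventually.of_forall fun t =>
      ((hf.1.add (hg.1.const_mul _)).norm.aemeasurable.pow_const _).aestronglyMeasurable)
    (by simpa using hf.integrable_norm_rpow hp0 hp)
    (by
      have := hint.re.1.const_mul p.toReal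
      refine this.congr (ae_of_all _ fun x => ?_)
      simp only [RCLike.re_eq_complex_re, hre])
    (ae_of_all _ fun x => lipschitzOnWith_norm_add_mul_rpow _ _ hq)
    ((integrable_norm_add_norm_rpow hp0 hp hf hg).const_mul _)
    (hf0.mono fun x hx => hasDerivAt_norm_add_mul_rpow hx _)
  have hz := IsLocalMin.hasDerivAt_eq_zero
    (Eventually.of_forall fun t => by simpa using hmin t) hd.2
  rw [integral_const_mul] at hz
  have h0 := (mul_eq_zero.1 hz).resolve_left (by positivity)
  rw [← h0]
  refine (integral_re hint).symm.trans (integral_congr_ae (ae_of_all _ fun x => ?_))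
  simp only [RCLike.re_eq_complex_re, hre]

/-- If `f` has minimal `p`-norm on the line `f + ℂ g`, then `|f| ^ (p - 2) f` is orthogonal to
`g`. -/
theorem integral_eq_zero_of_norm_minimal {p : ℝ≥0∞} (hp1 : 1 ≤ p) (hp : p ≠ ∞) {f g : α → ℂ}
    (hf : MemLp f p μ) (hg : MemLp g p μ) (hf0 : ∀ᵐ x ∂μ, f x ≠ 0)
    (hmin : ∀ c : ℂ, ∫ x, ‖f x‖ ^ p.toReal ∂μ ≤ ∫ x, ‖f x + c * g x‖ ^ p.toReal ∂μ) :
    ∫ x, ((‖f x‖ ^ (p.toReal - 2) : ℝ) : ℂ) * (conj (f x) * g x) ∂μ = 0 := by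
  have h1 := re_integral_eq_zero_of_norm_minimal hp1 hp hf hg hf0 fun t => hmin t
  -- Replacing `g` by `i g` yields the imaginary part.
  have h2 := re_integral_eq_zero_of_norm_minimal hp1 hp hf (hg.const_mul Complex.I) hf0
    fun t => by simpa [mul_assoc] using hmin (t * Complex.I)
  have h3 : ∫ x, ((‖f x‖ ^ (p.toReal - 2) : ℝ) : ℂ) * (conj (f x) * (Complex.I * g x)) ∂μ
      = Complex.I * ∫ x, ((‖f x‖ ^ (p.toReal - 2) : ℝ) : ℂ) * (conj (f x) * g x) ∂μ := by
    rw [← integral_const_mul]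
    congr 1; funext x; ring
  rw [h3, Complex.I_mul_re, neg_eq_zero] at h2
  exact Complex.ext h1 h2

end NormMinimality

/-! ### Moments of unitarily invariant measures. -/

section UnitarilyInvariant

open Filter Topology ComplexConjugate

theorem norm_rpow_mul_conj_mul_self (z : ℂ) {q : ℝ} (hq : 1 ≤ q) :
    ((‖z‖ ^ (q - 2) : ℝ) : ℂ) * (conj z * z) = ((‖z‖ ^ q : ℝ) : ℂ) := by
  rcases eq_or_ne z 0 with rfl | hz
  · simp [Real.zero_rpow (by linarith : q ≠ 0)]
  · have : 0 < ‖z‖ := norm_pos_iff.2 hz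
    rw [Complex.conj_mul', ← Complex.ofReal_pow, ← Complex.ofReal_mul, ← Real.rpow_natCast,
      ← Real.rpow_add this]
    congr 2; push_cast; ring

variable {E : Type*} [NormedAddCommGroup E] [InnerProductSpace ℂ E]

theorem exists_linearIsometryEquiv_apply_eq [FiniteDimensional ℂ E] {u v : E} (hu : ‖u‖ = 1)
    (hv : ‖v‖ = 1) : ∃ U : E ≃ₗᵢ[ℂ] E, U u = v := by
  have hu0 : u ≠ 0 := by rintro rfl; simp at hu
  have : Nontrivial E := ⟨u, 0, hu0⟩
  have hpos : 0 < Module.finrank ℂ E := Module.finrank_pos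
  let i : Fin (Module.finrank ℂ E) := ⟨0, hpos⟩
  have key : ∀ w : E, ‖w‖ = 1 → ∃ b : OrthonormalBasis (Fin (Module.finrank ℂ E)) ℂ E,
      b i = w := by
    intro w hw
    obtain ⟨b, hb⟩ := Orthonormal.exists_orthonormalBasis_extension_of_card_eq (𝕜 := ℂ) (E := E)
      (ι := Fin (Module.finrank ℂ E)) (by simp) (v := fun _ => w) (s := {i})
      ⟨fun j => hw, fun j k hjk => (hjk (Subsingleton.elim j k)).elim⟩
    exact ⟨b, hb i rfl⟩
  obtain ⟨b, hb⟩ := key u hu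
  obtain ⟨b', hb'⟩ := key v hv
  refine ⟨b.equiv b' (Equiv.refl _), ?_⟩
  rw [← hb, ← hb', OrthonormalBasis.equiv_apply_basis]
  rfl

variable [MeasurableSpace E] [BorelSpace E]

/-- A finite measure on the closed unit ball which is invariant under unitary maps and does not
concentrate on a hyperplane. -/
structure IsUnitarilyInvariant (ν : Measure E) : Prop where
  finite : IsFiniteMeasure ν
  measurePreserving : ∀ U : E ≃ₗᵢ[ℂ] E, MeasurePreserving U ν ν
  norm_le_one : ∀ᵐ t ∂ν, ‖t‖ ≤ 1
  inner_ne_zero : ∀ u : E, u ≠ 0 → ν {t | inner ℂ u t ≠ 0} ≠ 0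

/-- Lebesgue measure restricted to the closed unit ball has all the properties. -/
theorem exists_isUnitarilyInvariant [FiniteDimensional ℂ E] :
    ∃ ν : Measure E, IsUnitarilyInvariant ν := by
  let _ : InnerProductSpace ℝ E := InnerProductSpace.complexToReal
  have : FiniteDimensional ℝ E := FiniteDimensional.complexToReal E
  refine ⟨(volume : Measure E).restrict (Metric.closedBall 0 1), ?_, ?_, ?_, ?_⟩
  · exact ⟨by simpa using (isCompact_closedBall (0 : E) 1).measure_lt_top⟩
  · intro U
    let V : E ≃ₗᵢ[ℝ] E := ⟨U.toLinearEquiv.restrictScalars ℝ, U.norm_map⟩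
    have h := (LinearIsometryEquiv.measurePreserving V).restrict_preimage
      (measurableSet_closedBall (x := (0 : E)) (ε := 1))
    have hpre : V ⁻¹' Metric.closedBall 0 1 = Metric.closedBall 0 1 := by
      ext t
      simp
    rw [hpre] at h
    exact h
  · refine (ae_restrict_mem measurableSet_closedBall).mono fun t ht => by simpa using ht
  · intro u hu
    have hopen : IsOpen ({t : E | inner ℂ u t ≠ 0} ∩ Metric.ball 0 1) :=
      (isOpen_ne_fun (by fun_prop) continuous_const).inter Metric.isOpen_ball
    have hne : ({t : E | inner ℂ u t ≠ 0} ∩ Metric.ball 0 1).Nonempty := by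
      have hu' : 0 < ‖u‖ := norm_pos_iff.2 hu
      refine ⟨((2 * ‖u‖ : ℝ) : ℂ)⁻¹ • u, ?_, ?_⟩
      · change inner ℂ u _ ≠ 0
        rw [inner_smul_right]
        exact mul_ne_zero (inv_ne_zero (by exact_mod_cast (by positivity : 2 * ‖u‖ ≠ 0)))
          (inner_self_ne_zero.2 hu)
      · rw [mem_ball_zero_iff, norm_smul, norm_inv, Complex.norm_real,
          Real.norm_of_nonneg (by positivity)]
        field_simp
        norm_num
    refine (lt_of_lt_of_le (hopen.measure_pos volume hne) ?_).ne'
    rw [Measure.restrict_apply (isOpen_ne_fun (by fun_prop) continuous_const).measurableSet]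
    exact measure_mono (Set.inter_subset_inter_right _ Metric.ball_subset_closedBall)

variable {ν : Measure E}

theorem IsUnitarilyInvariant.integrable (hν : IsUnitarilyInvariant ν) {q : ℝ} (hq : 1 ≤ q)
    (a w : E) :
    Integrable (fun t => ((‖inner ℂ a t‖ ^ (q - 2) : ℝ) : ℂ) *
      (conj (inner ℂ a t) * inner ℂ w t)) ν := by
  have := hν.finite
  refine (integrable_const ((‖a‖ + ‖w‖) ^ q)).mono' ?_ ?_
  · refine Measurable.aestronglyMeasurable ?_
    fun_prop
  · filter_upwards [hν.norm_le_one] with t ht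
    refine (norm_rpow_mul_conj_mul_le _ _ hq).trans ?_
    have h : ∀ v : E, ‖inner ℂ v t‖ ≤ ‖v‖ := fun v =>
      (norm_inner_le_norm v t).trans (mul_le_of_le_one_right (norm_nonneg _) ht)
    gcongr
    · exact h a
    · exact h w

/-- The `q`-th moments of a unitarily invariant measure. -/
theorem IsUnitarilyInvariant.exists_integral_eq [FiniteDimensional ℂ E]
    (hν : IsUnitarilyInvariant ν) {q : ℝ} (hq : 1 ≤ q) :
    ∃ C : ℝ, 0 < C ∧ ∀ a w : E, ∫ t, ((‖inner ℂ a t‖ ^ (q - 2) : ℝ) : ℂ) *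
      (conj (inner ℂ a t) * inner ℂ w t) ∂ν
        = (C : ℂ) * (((‖a‖ ^ (q - 2) : ℝ) : ℂ) * inner ℂ w a) := by
  have := hν.finite
  rcases subsingleton_or_nontrivial E with hE | hE
  · refine ⟨1, one_pos, fun a w => ?_⟩
    simp [Subsingleton.elim a 0, Subsingleton.elim w 0]
  obtain ⟨u₀, hu₀⟩ := exists_norm_eq E zero_le_one
  have hmoment : ∀ u : E, ∫ t, ((‖inner ℂ u t‖ ^ (q - 2) : ℝ) : ℂ) *
      (conj (inner ℂ u t) * inner ℂ u t) ∂ν = ((∫ t, ‖inner ℂ u t‖ ^ q ∂ν : ℝ) : ℂ) := fun u => by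
    refine Eq.trans ?_ integral_ofReal
    congr 1; funext t
    exact norm_rpow_mul_conj_mul_self _ hq
  -- The unitary group is transitive on the unit sphere, so the moment is the same for all unit
  -- vectors; this common value is the constant `C`.
  have hunit : ∀ u : E, ‖u‖ = 1 → ∫ t, ‖inner ℂ u t‖ ^ q ∂ν = ∫ t, ‖inner ℂ u₀ t‖ ^ q ∂ν := by
    intro u hu
    obtain ⟨U, rfl⟩ := exists_linearIsometryEquiv_apply_eq hu₀ hu
    rw [← (hν.measurePreserving U).integral_comp U.toHomeomorph.measurableEmbedding]
    simp
  have hint : ∀ u : E, Integrable (fun t => ‖inner ℂ u t‖ ^ q) ν := fun u => by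
    refine (hν.integrable hq u u).norm.congr (ae_of_all _ fun t => ?_)
    simp only [norm_rpow_mul_conj_mul_self _ hq, Complex.norm_real]
    exact Real.norm_of_nonneg (by positivity)
  refine ⟨∫ t, ‖inner ℂ u₀ t‖ ^ q ∂ν, ?_, fun a w => ?_⟩
  · rw [integral_pos_iff_support_of_nonneg (fun t => by positivity) (hint _), pos_iff_ne_zero]
    have : (Function.support fun t => ‖inner ℂ u₀ t‖ ^ q) = {t | inner ℂ u₀ t ≠ 0} := by
      ext t
      simp [Real.rpow_eq_zero (norm_nonneg _) (by linarith : q ≠ 0)]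
    rw [this]
    exact hν.inner_ne_zero u₀ (by rintro rfl; simp at hu₀)
  rcases eq_or_ne a 0 with rfl | ha
  · simp
  have hna : 0 < ‖a‖ := norm_pos_iff.2 ha
  have hself : ∫ t, ‖inner ℂ a t‖ ^ q ∂ν = ‖a‖ ^ q * ∫ t, ‖inner ℂ u₀ t‖ ^ q ∂ν := by
    rw [← hunit (((‖a‖ : ℂ)⁻¹) • a) (by rw [norm_smul]; simp [hna.ne']), ← integral_const_mul]
    congr 1; funext t
    rw [← Real.mul_rpow (norm_nonneg _) (norm_nonneg _), inner_smul_left, norm_mul,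
      ← mul_assoc]
    simp [hna.ne']
  have horth : ∀ w' : E, inner ℂ a w' = 0 → ∫ t, ((‖inner ℂ a t‖ ^ (q - 2) : ℝ) : ℂ) *
      (conj (inner ℂ a t) * inner ℂ w' t) ∂ν = 0 := by
    intro w' hw'
    -- The reflection in the line of `a` fixes `a` and negates `w'`, so by invariance the integral
    -- equals its own negative.
    let R := (ℂ ∙ a).reflection
    have hRa : R a = a :=
      Submodule.reflection_mem_subspace_eq_self (Submodule.mem_span_singleton_self a)
    have hRw : R w' = -w' := Submodule.reflection_mem_subspace_orthogonalComplement_eq_neg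
      (Submodule.mem_orthogonal_singleton_iff_inner_right.2 hw')
    have h1 : ∀ t, inner ℂ a (R t) = inner ℂ a t := fun t => by
      conv_lhs => rw [← hRa]
      exact R.inner_map_map a t
    have h2 : ∀ t, inner ℂ w' (R t) = -inner ℂ w' t := fun t => by
      have : w' = R (-w') := by rw [map_neg, hRw, neg_neg]
      conv_lhs => rw [this]
      rw [R.inner_map_map, inner_neg_left]
    have h := (hν.measurePreserving R).integral_comp R.toHomeomorph.measurableEmbedding
      (fun t => ((‖inner ℂ a t‖ ^ (q - 2) : ℝ) : ℂ) * (conj (inner ℂ a t) * inner ℂ w' t))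
    simp only [h1, h2, mul_neg, integral_neg] at h
    exact self_eq_neg.1 h.symm
  -- Decompose `w` into `conj c • a` and a part orthogonal to `a`; only the first contributes.
  set c : ℂ := inner ℂ w a / (‖a‖ : ℂ) ^ 2 with hc
  have hac : inner ℂ w a = c * (‖a‖ : ℂ) ^ 2 := by
    rw [hc, div_mul_cancel₀]
    exact pow_ne_zero _ (by exact_mod_cast hna.ne')
  have hw' : inner ℂ a (w - conj c • a) = 0 := by
    rw [inner_sub_right, inner_smul_right, inner_self_eq_norm_sq_to_K, ← inner_conj_symm, hac]
    simp
  have hsplit : ∀ t, ((‖inner ℂ a t‖ ^ (q - 2) : ℝ) : ℂ) * (conj (inner ℂ a t) * inner ℂ w t)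
      = c * (((‖inner ℂ a t‖ ^ (q - 2) : ℝ) : ℂ) * (conj (inner ℂ a t) * inner ℂ a t))
        + ((‖inner ℂ a t‖ ^ (q - 2) : ℝ) : ℂ) *
          (conj (inner ℂ a t) * inner ℂ (w - conj c • a) t) := fun t => by
    rw [inner_sub_left, inner_smul_left, Complex.conj_conj]; ring
  simp only [hsplit]
  rw [integral_add ((hν.integrable hq a a).const_mul c) (hν.integrable hq _ _),
    integral_const_mul, horth _ hw', hmoment, hself, hac, add_zero]
  have hpow : ‖a‖ ^ q = ‖a‖ ^ (q - 2) * ‖a‖ ^ 2 := by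
    rw [← Real.rpow_natCast, ← Real.rpow_add hna]; congr 1; push_cast; ring
  rw [hpow]
  push_cast
  ring

end UnitarilyInvariant

/-! ### Averaging over linear combinations. -/

section Averaging

open Filter Topology ComplexConjugate

variable {α : Type*} {ι : Type*} [Fintype ι]

/-- The conjugate of a tuple of functions as a function into Euclidean space. -/
noncomputable def conjTuple (f : ι → α → ℂ) (x : α) : EuclideanSpace ℂ ι :=
  WithLp.toLp 2 fun i => conj (f i x)

/-- The inner product is conjugate-linear in its first argument; the conjugation in `conjTuple`
cancels this. -/
theorem inner_conjTuple (f : ι → α → ℂ) (x : α) (t : EuclideanSpace ℂ ι) :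
    inner ℂ (conjTuple f x) t = ∑ i, t i * f i x := by
  simp [conjTuple, PiLp.inner_apply]

theorem norm_conjTuple_sq (f : ι → α → ℂ) (x : α) :
    ‖conjTuple f x‖ ^ 2 = ∑ i, ‖f i x‖ ^ 2 := by
  simp [conjTuple, EuclideanSpace.norm_sq_eq]

variable [MeasurableSpace α] {μ : Measure α}

theorem measurable_conjTuple {f : ι → α → ℂ} (hf : ∀ i, Measurable (f i)) :
    Measurable (conjTuple f) :=
  (PiLp.continuous_toLp 2 _).measurable.comp
    (measurable_pi_lambda _ fun i => Complex.continuous_conj.measurable.comp (hf i))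

theorem memLp_conjTuple {p : ℝ≥0∞} {f : ι → α → ℂ} (hfm : ∀ i, Measurable (f i))
    (hf : ∀ i, MemLp (f i) p μ) : MemLp (conjTuple f) p μ := by
  have hs : MemLp (fun x => ∑ i, ‖f i x‖) p μ := memLp_finsetSum _ fun i _ => (hf i).norm
  refine hs.of_le (measurable_conjTuple hfm).aestronglyMeasurable (ae_of_all _ fun x => ?_)
  rw [Real.norm_of_nonneg (by positivity)]
  refine (sq_le_sq₀ (norm_nonneg _) (by positivity)).1 ?_
  rw [norm_conjTuple_sq]
  exact Finset.sum_sq_le_sq_sum_of_nonneg fun i _ => norm_nonneg _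

/-- If `|h| ^ (p - 2) h` is orthogonal to `g` for all linear combinations `h` of `f i`, then so
is `(∑ |f i| ^ 2) ^ ((p - 2) / 2) f i` for all `i`. -/
theorem integral_norm_conjTuple_rpow_mul_eq_zero {p : ℝ≥0∞} (hp1 : 1 ≤ p) (hp : p ≠ ∞)
    [SFinite μ] {f : ι → α → ℂ} (hfm : ∀ i, Measurable (f i)) (hf : ∀ i, MemLp (f i) p μ)
    {g : α → ℂ} (hgm : Measurable g) (hg : MemLp g p μ)
    (h : ∀ t : ι → ℂ, ∫ x, ((‖∑ i, t i * f i x‖ ^ (p.toReal - 2) : ℝ) : ℂ) *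
      (conj (∑ i, t i * f i x) * g x) ∂μ = 0) (i : ι) :
    ∫ x, ((‖conjTuple f x‖ ^ (p.toReal - 2) : ℝ) : ℂ) * (conj (f i x) * g x) ∂μ = 0 := by
  classical
  have hq : 1 ≤ p.toReal := by simpa using ENNReal.toReal_mono hp hp1
  obtain ⟨ν, hν⟩ := exists_isUnitarilyInvariant (E := EuclideanSpace ℂ ι)
  have := hν.finite
  obtain ⟨C, hC, hCeq⟩ := hν.exists_integral_eq hq
  have ha := memLp_conjTuple hfm hf
  have ham := measurable_conjTuple hfm
  have hcoord : ∀ t : EuclideanSpace ℂ ι,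
      inner ℂ (EuclideanSpace.single i (1 : ℂ)) t = t i := fun t => by
    simp [EuclideanSpace.inner_single_left]
  have hint : Integrable (fun z : α × EuclideanSpace ℂ ι =>
      ((‖inner ℂ (conjTuple f z.1) z.2‖ ^ (p.toReal - 2) : ℝ) : ℂ) *
        (conj (inner ℂ (conjTuple f z.1) z.2) * z.2 i) * g z.1) (μ.prod ν) := by
    have hb : Integrable (fun x => (‖conjTuple f x‖ + ‖g x‖) ^ p.toReal) μ := by
      refine ((ha.norm.add hg.norm).integrable_norm_rpow (by positivity) hp).congr
        (ae_of_all _ fun x => ?_)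
      simp only [Pi.add_apply]
      rw [Real.norm_of_nonneg (by positivity)]
    refine (hb.comp_fst ν).mono' ?_ ?_
    · have h1 : Measurable fun z : α × EuclideanSpace ℂ ι => inner ℂ (conjTuple f z.1) z.2 :=
        (ham.comp measurable_fst).inner measurable_snd
      have h2 : Measurable fun z : α × EuclideanSpace ℂ ι => z.2 i :=
        (PiLp.continuous_apply 2 (fun _ : ι => ℂ) i).measurable.comp measurable_snd
      have h3 : Measurable fun z : α × EuclideanSpace ℂ ι => g z.1 := hgm.comp measurable_fst
      refine Measurable.aestronglyMeasurable ?_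
      exact ((Complex.measurable_ofReal.comp (h1.norm.pow_const _)).mul
        ((Complex.continuous_conj.measurable.comp h1).mul h2)).mul h3
    · have hν1 : ∀ᵐ z ∂(μ.prod ν), ‖z.2‖ ≤ 1 :=
        Measure.quasiMeasurePreserving_snd.ae hν.norm_le_one
      filter_upwards [hν1] with z hz
      have e : ((‖inner ℂ (conjTuple f z.1) z.2‖ ^ (p.toReal - 2) : ℝ) : ℂ) *
          (conj (inner ℂ (conjTuple f z.1) z.2) * z.2 i) * g z.1
          = (((‖inner ℂ (conjTuple f z.1) z.2‖ ^ (p.toReal - 2) : ℝ) : ℂ) *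
          (conj (inner ℂ (conjTuple f z.1) z.2) * g z.1)) * z.2 i := by ring
      rw [e, norm_mul]
      refine (mul_le_of_le_one_right (norm_nonneg _)
        ((PiLp.norm_apply_le z.2 i).trans hz)).trans ?_
      refine (norm_rpow_mul_conj_mul_le _ _ hq).trans ?_
      gcongr
      exact (norm_inner_le_norm _ _).trans (mul_le_of_le_one_right (norm_nonneg _) hz)
  -- Fubini for the hypothesis multiplied by `t i`. Integrating over `x` first gives zero;
  -- integrating over `t` first, the moment formula with `w` the `i`-th unit vector produces the
  -- averaged weight.
  have hswap := integral_integral_swap (f := fun x t =>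
      ((‖inner ℂ (conjTuple f x) t‖ ^ (p.toReal - 2) : ℝ) : ℂ) *
        (conj (inner ℂ (conjTuple f x) t) * t i) * g x) hint
  have hleft : ∀ x, ∫ t, ((‖inner ℂ (conjTuple f x) t‖ ^ (p.toReal - 2) : ℝ) : ℂ) *
        (conj (inner ℂ (conjTuple f x) t) * t i) * g x ∂ν
      = (C : ℂ) * (((‖conjTuple f x‖ ^ (p.toReal - 2) : ℝ) : ℂ) * (conj (f i x) * g x)) := by
    intro x
    have := hCeq (conjTuple f x) (EuclideanSpace.single i 1)
    simp only [hcoord] at this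
    rw [integral_mul_const, this]
    simp only [conjTuple]
    ring
  have hright : ∀ t : EuclideanSpace ℂ ι,
      ∫ x, ((‖inner ℂ (conjTuple f x) t‖ ^ (p.toReal - 2) : ℝ) : ℂ) *
        (conj (inner ℂ (conjTuple f x) t) * t i) * g x ∂μ = 0 := by
    intro t
    have := h t
    simp only [inner_conjTuple]
    rw [← mul_zero (t i), ← this, ← integral_const_mul]
    congr 1; funext x; ring
  simp only [hleft, hright, integral_zero, integral_const_mul] at hswap
  exact (mul_eq_zero.1 hswap).resolve_left (by exact_mod_cast hC.ne')

end Averaging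

/-- A pencil of linear maps with an injective member has an eigenvector. -/
theorem exists_apply_eq_smul_apply {K V W : Type*} [Field K] [IsAlgClosed K] [AddCommGroup V]
    [Module K V] [AddCommGroup W] [Module K W] [FiniteDimensional K V] [FiniteDimensional K W]
    [Nontrivial V] {A : V →ₗ[K] W} (hA : Function.Injective A)
    (hdim : Module.finrank K V = Module.finrank K W) (B : V →ₗ[K] W) :
    ∃ c : K, ∃ v : V, v ≠ 0 ∧ B v = c • A v := by
  -- By equality of dimensions `A` is invertible, so an eigenvector of `A⁻¹ B` serves.
  let e := LinearEquiv.ofInjectiveOfFinrankEq A hA hdim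
  obtain ⟨c, hc⟩ := Module.End.exists_eigenvalue (e.symm.toLinearMap ∘ₗ B)
  obtain ⟨v, hv⟩ := hc.exists_hasEigenvector
  refine ⟨c, v, hv.2, ?_⟩
  have h := congrArg e hv.apply_eq_smul
  rw [map_smul, LinearMap.comp_apply, LinearEquiv.coe_coe, e.apply_symm_apply] at h
  exact h

/-! ### Contractive projections of the Hardy space and their orthogonality weights. -/

section HardySpace

open Filter Topology ComplexConjugate

variable {p : ℝ≥0∞} [Fact (1 ≤ p)]

/-- The representative of an element of the Hardy space. -/
noncomputable def boundaryFn (f : hardySpace p) : AddCircle (2 * Real.pi) → ℂ :=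
  (f : Lp ℂ p (haarAddCircle (T := 2 * Real.pi)))

theorem measurable_boundaryFn (f : hardySpace p) : Measurable (boundaryFn f) :=
  (Lp.stronglyMeasurable _).measurable

theorem memLp_boundaryFn (f : hardySpace p) : MemLp (boundaryFn f) p haarAddCircle :=
  Lp.memLp _

theorem boundaryFn_add (f g : hardySpace p) :
    boundaryFn (f + g) =ᵐ[haarAddCircle] fun x => boundaryFn f x + boundaryFn g x :=
  Lp.coeFn_add (f : Lp ℂ p (haarAddCircle (T := 2 * Real.pi))) g

theorem boundaryFn_smul (c : ℂ) (f : hardySpace p) :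
    boundaryFn (c • f) =ᵐ[haarAddCircle] fun x => c * boundaryFn f x :=
  Lp.coeFn_smul c (f : Lp ℂ p (haarAddCircle (T := 2 * Real.pi)))

theorem boundaryFn_zero : boundaryFn (0 : hardySpace p) =ᵐ[haarAddCircle] 0 :=
  Lp.coeFn_zero ℂ p (haarAddCircle (T := 2 * Real.pi))

theorem boundaryFn_ext {f g : hardySpace p}
    (h : boundaryFn f =ᵐ[haarAddCircle] boundaryFn g) : f = g :=
  Subtype.ext (Lp.ext h)

theorem boundaryFn_sum {ι : Type*} (s : Finset ι) (f : ι → hardySpace p) :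
    boundaryFn (∑ i ∈ s, f i) =ᵐ[haarAddCircle] fun x => ∑ i ∈ s, boundaryFn (f i) x := by
  classical
  induction s using Finset.induction_on with
  | empty => simpa using! boundaryFn_zero
  | insert a s ha ih =>
    rw [Finset.sum_insert ha]
    filter_upwards [boundaryFn_add (f a) (∑ i ∈ s, f i), ih] with x h1 h2
    rw [h1, h2, Finset.sum_insert ha]

theorem integral_norm_boundaryFn_rpow (hp : p ≠ ∞) (f : hardySpace p) :
    ∫ x, ‖boundaryFn f x‖ ^ p.toReal ∂haarAddCircle = ‖f‖ ^ p.toReal := by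
  have hp0 : p ≠ 0 := (zero_lt_one.trans_le Fact.out).ne'
  have h : ‖f‖ = (eLpNorm (boundaryFn f) p haarAddCircle).toReal := Lp.norm_def _
  have hq : p.toReal ≠ 0 := (ENNReal.toReal_pos hp0 hp).ne'
  have hnn : 0 ≤ ∫ x, ‖boundaryFn f x‖ ^ p.toReal ∂haarAddCircle :=
    integral_nonneg fun x => by positivity
  rw [h, (memLp_boundaryFn f).eLpNorm_eq_integral_rpow_norm hp0 hp,
    ENNReal.toReal_ofReal (by positivity), ← Real.rpow_mul hnn, inv_mul_cancel₀ hq, Real.rpow_one]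

theorem isAnalyticL1_boundaryFn (f : hardySpace p) : IsAnalyticL1 (boundaryFn f) := by
  refine ⟨(memLp_boundaryFn f).integrable Fact.out, fun n hn => ?_⟩
  have := f.2 n hn
  simpa only [fourierCoeff, neg_neg, smul_eq_mul] using! this

theorem boundaryFn_ae_ne_zero {f : hardySpace p} (hf : f ≠ 0) :
    ∀ᵐ x ∂haarAddCircle, boundaryFn f x ≠ 0 :=
  (isAnalyticL1_boundaryFn f).ae_ne_zero (measurable_boundaryFn f) fun h =>
    hf (boundaryFn_ext (h.trans boundaryFn_zero.symm))

/-- Supplies the test functions `e^{inθ} f` that stay in the Hardy space. -/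
theorem exists_boundaryFn_eq_fourier_mul (n : ℕ) (f : hardySpace p) :
    ∃ g : hardySpace p,
      boundaryFn g =ᵐ[haarAddCircle] fun x => fourier (n : ℤ) x * boundaryFn f x := by
  have hm : MemLp (fun x => fourier (n : ℤ) x * boundaryFn f x) p haarAddCircle := by
    refine (memLp_boundaryFn f).of_le
      ((fourier (n : ℤ)).continuous.aestronglyMeasurable.mul (memLp_boundaryFn f).1)
      (ae_of_all _ fun x => ?_)
    rw [norm_mul, fourier_apply, Circle.norm_coe, one_mul]
  refine ⟨⟨hm.toLp _, fun m hm0 => ?_⟩, hm.coeFn_toLp⟩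
  rw [fourierCoeff_congr_ae hm.coeFn_toLp]
  have := (isAnalyticL1_boundaryFn f).2 (m + n) (by omega)
  simpa only [fourierCoeff, neg_neg, smul_eq_mul, Nat.cast_add, fourier_add, mul_assoc] using this

variable {P : hardySpace p →L[ℂ] hardySpace p}

theorem integral_norm_rpow_mul_conj_mul_eq_zero (hp : p ≠ ∞) (hP : ‖P‖ ≤ 1) {f g : hardySpace p}
    (hf : P f = f) (hg : P g = 0) :
    ∫ x, ((‖boundaryFn f x‖ ^ (p.toReal - 2) : ℝ) : ℂ) *
      (conj (boundaryFn f x) * boundaryFn g x) ∂haarAddCircle = 0 := by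
  rcases eq_or_ne f 0 with rfl | hf0
  · refine integral_eq_zero_of_ae ?_
    filter_upwards [boundaryFn_zero (p := p)] with x hx
    simp [hx]
  refine integral_eq_zero_of_norm_minimal Fact.out hp (memLp_boundaryFn f) (memLp_boundaryFn g)
    (boundaryFn_ae_ne_zero hf0) fun c => ?_
  have h1 : ‖f‖ ≤ ‖f + c • g‖ := by
    have := P.le_of_opNorm_le hP (f + c • g)
    rwa [map_add, map_smul, hf, hg, smul_zero, add_zero, one_mul] at this
  have h2 : ∫ x, ‖boundaryFn f x + c * boundaryFn g x‖ ^ p.toReal ∂haarAddCircle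
      = ‖f + c • g‖ ^ p.toReal := by
    rw [← integral_norm_boundaryFn_rpow hp]
    refine integral_congr_ae ?_
    filter_upwards [boundaryFn_add f (c • g), boundaryFn_smul c g] with x hx hx'
    rw [hx, hx']
  rw [h2, integral_norm_boundaryFn_rpow hp]
  gcongr

/-- A positive weight `w` such that the sesquilinear form `∫ w conj h k` is defined for `h` in the
range of the projection `P`, and makes the range and the kernel of `P` orthogonal. -/
structure IsOrthogonalityWeight (P : hardySpace p →L[ℂ] hardySpace p)
    (w : AddCircle (2 * Real.pi) → ℝ) : Prop where
  pos : ∀ᵐ x ∂haarAddCircle, 0 < w x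
  integrable : ∀ h k : hardySpace p, P h = h →
    Integrable (fun x => (w x : ℂ) * (conj (boundaryFn h x) * boundaryFn k x)) haarAddCircle
  integral_eq_zero : ∀ h k : hardySpace p, P h = h → P k = 0 →
    ∫ x, (w x : ℂ) * (conj (boundaryFn h x) * boundaryFn k x) ∂haarAddCircle = 0

/-- The family need only span the range, not be independent: this allows enlarging a basis by a
further vector, which changes the weight. Averaging treats the members of the family;
conjugate-linearity extends the result to their span. -/
theorem isOrthogonalityWeight_norm_conjTuple (hp : p ≠ ∞) (hP : ‖P‖ ≤ 1) {ι : Type*} [Fintype ι]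
    {v : ι → hardySpace p} (hPv : ∀ i, P (v i) = v i) (hv0 : ∃ i, v i ≠ 0)
    (hspan : ∀ h, P h = h → h ∈ Submodule.span ℂ (Set.range v)) :
    IsOrthogonalityWeight P
      fun x => ‖conjTuple (fun i => boundaryFn (v i)) x‖ ^ (p.toReal - 2) := by
  have hq : 1 ≤ p.toReal := by
    simpa using ENNReal.toReal_mono hp (Fact.out : 1 ≤ p)
  have hm : ∀ i, Measurable (boundaryFn (v i)) := fun i => measurable_boundaryFn _
  have hL : ∀ i, MemLp (boundaryFn (v i)) p haarAddCircle := fun i => memLp_boundaryFn _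
  have hpos : ∀ᵐ x ∂haarAddCircle, 0 < ‖conjTuple (fun i => boundaryFn (v i)) x‖ := by
    obtain ⟨i, hi⟩ := hv0
    filter_upwards [boundaryFn_ae_ne_zero hi] with x hx
    refine norm_pos_iff.2 fun h0 => hx ?_
    have : conjTuple (fun i => boundaryFn (v i)) x i = 0 := by rw [h0]; rfl
    simpa [conjTuple] using this
  have key : ∀ h ∈ Submodule.span ℂ (Set.range v), ∀ k : hardySpace p,
      Integrable (fun x => ((‖conjTuple (fun i => boundaryFn (v i)) x‖ ^ (p.toReal - 2) : ℝ) : ℂ) *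
        (conj (boundaryFn h x) * boundaryFn k x)) haarAddCircle ∧
      (P k = 0 →
        ∫ x, ((‖conjTuple (fun i => boundaryFn (v i)) x‖ ^ (p.toReal - 2) : ℝ) : ℂ) *
          (conj (boundaryFn h x) * boundaryFn k x) ∂haarAddCircle = 0) := by
    intro h hh k
    induction hh using Submodule.span_induction with
    | mem h hh =>
      obtain ⟨i, rfl⟩ := hh
      constructor
      · have ha := memLp_conjTuple hm hL
        have ham := measurable_conjTuple hm
        have hb : Integrable (fun x => (‖conjTuple (fun i => boundaryFn (v i)) x‖
            + ‖boundaryFn k x‖) ^ p.toReal) haarAddCircle := by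
          refine ((ha.norm.add (memLp_boundaryFn k).norm).integrable_norm_rpow
            (zero_lt_one.trans_le Fact.out).ne' hp).congr (ae_of_all _ fun x => ?_)
          simp only [Pi.add_apply]
          rw [Real.norm_of_nonneg (by positivity)]
        refine hb.mono' ?_ ?_
        · exact ((Complex.measurable_ofReal.comp (ham.norm.pow_const _)).mul
            ((Complex.continuous_conj.measurable.comp (hm i)).mul
              (measurable_boundaryFn k))).aestronglyMeasurable
        · filter_upwards [hpos] with x hx
          have h1 : ‖boundaryFn (v i) x‖ ≤ ‖conjTuple (fun i => boundaryFn (v i)) x‖ := by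
            have := PiLp.norm_apply_le (conjTuple (fun i => boundaryFn (v i)) x) i
            simpa [conjTuple] using this
          -- The pointwise bound is applied to the length of the tuple as a complex number; that
          -- length dominates each `|v i|`.
          have h2 := norm_rpow_mul_conj_mul_le
            ((‖conjTuple (fun i => boundaryFn (v i)) x‖ : ℝ) : ℂ) (boundaryFn k x) hq
          rw [Complex.norm_real, norm_norm] at h2
          refine le_trans ?_ h2
          rw [norm_mul, norm_mul, norm_mul, norm_mul, RCLike.norm_conj, RCLike.norm_conj,
            Complex.norm_real (‖conjTuple (fun i => boundaryFn (v i)) x‖), norm_norm]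
          gcongr
      · intro hk
        refine integral_norm_conjTuple_rpow_mul_eq_zero Fact.out hp hm hL
          (measurable_boundaryFn k) (memLp_boundaryFn k) (fun t => ?_) i
        have hPt : P (∑ i, t i • v i) = ∑ i, t i • v i := by simp [hPv]
        rw [← integral_norm_rpow_mul_conj_mul_eq_zero hp hP hPt hk]
        refine integral_congr_ae ?_
        filter_upwards [boundaryFn_sum Finset.univ (fun i => t i • v i),
          eventually_all.2 fun i => boundaryFn_smul (t i) (v i)] with x hx hx'
        simp only [hx, hx']
    | zero =>
      have h0 : (fun x => ((‖conjTuple (fun i => boundaryFn (v i)) x‖ ^ (p.toReal - 2) : ℝ) : ℂ) *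
          (conj (boundaryFn (0 : hardySpace p) x) * boundaryFn k x)) =ᵐ[haarAddCircle]
          fun _ => 0 := by
        filter_upwards [boundaryFn_zero (p := p)] with x hx
        simp [hx]
      exact ⟨(integrable_zero _ _ _).congr h0.symm, fun _ => integral_eq_zero_of_ae h0⟩
    | add h h' _ _ ih ih' =>
      have h0 : (fun x => ((‖conjTuple (fun i => boundaryFn (v i)) x‖ ^ (p.toReal - 2) : ℝ) : ℂ) *
          (conj (boundaryFn (h + h') x) * boundaryFn k x)) =ᵐ[haarAddCircle] fun x =>
          ((‖conjTuple (fun i => boundaryFn (v i)) x‖ ^ (p.toReal - 2) : ℝ) : ℂ) *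
            (conj (boundaryFn h x) * boundaryFn k x) +
          ((‖conjTuple (fun i => boundaryFn (v i)) x‖ ^ (p.toReal - 2) : ℝ) : ℂ) *
            (conj (boundaryFn h' x) * boundaryFn k x) := by
        filter_upwards [boundaryFn_add h h'] with x hx
        rw [hx, map_add]; ring
      refine ⟨(ih.1.add ih'.1).congr h0.symm, fun hk => ?_⟩
      rw [integral_congr_ae h0, integral_add ih.1 ih'.1, ih.2 hk, ih'.2 hk, add_zero]
    | smul c h _ ih =>
      have h0 : (fun x => ((‖conjTuple (fun i => boundaryFn (v i)) x‖ ^ (p.toReal - 2) : ℝ) : ℂ) *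
          (conj (boundaryFn (c • h) x) * boundaryFn k x)) =ᵐ[haarAddCircle] fun x =>
          conj c * (((‖conjTuple (fun i => boundaryFn (v i)) x‖ ^ (p.toReal - 2) : ℝ) : ℂ) *
            (conj (boundaryFn h x) * boundaryFn k x)) := by
        filter_upwards [boundaryFn_smul c h] with x hx
        rw [hx, map_mul]; ring
      refine ⟨(ih.1.const_mul _).congr h0.symm, fun hk => ?_⟩
      rw [integral_congr_ae h0, integral_const_mul, ih.2 hk, mul_zero]
  exact ⟨hpos.mono fun x hx => by positivity, fun h k hh => (key h (hspan h hh) k).1,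
    fun h k hh hk => (key h (hspan h hh) k).2 hk⟩

/-- The linear functional `k ↦ ∫ w conj h k`. -/
noncomputable def IsOrthogonalityWeight.functional {w : AddCircle (2 * Real.pi) → ℝ}
    (hw : IsOrthogonalityWeight P w) {h : hardySpace p} (hh : P h = h) : hardySpace p →ₗ[ℂ] ℂ where
  toFun k := ∫ x, (w x : ℂ) * (conj (boundaryFn h x) * boundaryFn k x) ∂haarAddCircle
  map_add' k l := by
    rw [← integral_add (hw.integrable h k hh) (hw.integrable h l hh)]
    refine integral_congr_ae ?_
    filter_upwards [boundaryFn_add k l] with x hx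
    rw [hx]; ring
  map_smul' c k := by
    rw [RingHom.id_apply, smul_eq_mul, ← integral_const_mul]
    refine integral_congr_ae ?_
    filter_upwards [boundaryFn_smul c k] with x hx
    rw [hx]; ring

theorem IsOrthogonalityWeight.functional_apply {w : AddCircle (2 * Real.pi) → ℝ}
    (hw : IsOrthogonalityWeight P w) {h : hardySpace p} (hh : P h = h) (k : hardySpace p) :
    hw.functional hh k
      = ∫ x, (w x : ℂ) * (conj (boundaryFn h x) * boundaryFn k x) ∂haarAddCircle := rfl

theorem IsOrthogonalityWeight.conj_functional {w : AddCircle (2 * Real.pi) → ℝ}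
    (hw : IsOrthogonalityWeight P w) {h k : hardySpace p} (hh : P h = h) (hk : P k = k) :
    conj (hw.functional hh k) = hw.functional hk h := by
  rw [functional_apply, functional_apply, ← integral_conj]
  congr 1; funext x
  simp only [map_mul, Complex.conj_conj, Complex.conj_ofReal]
  ring

theorem IsOrthogonalityWeight.integrable_norm_sq {w : AddCircle (2 * Real.pi) → ℝ}
    (hw : IsOrthogonalityWeight P w) {h : hardySpace p} (hh : P h = h) :
    Integrable (fun x => w x * ‖boundaryFn h x‖ ^ 2) haarAddCircle := by
  refine (hw.integrable h h hh).re.congr (ae_of_all _ fun x => ?_)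
  change ((w x : ℂ) * (conj (boundaryFn h x) * boundaryFn h x)).re = _
  rw [Complex.conj_mul', ← Complex.ofReal_pow, ← Complex.ofReal_mul]
  exact Complex.ofReal_re _

theorem IsOrthogonalityWeight.functional_self {w : AddCircle (2 * Real.pi) → ℝ}
    (hw : IsOrthogonalityWeight P w) {h : hardySpace p} (hh : P h = h) :
    hw.functional hh h
      = ((∫ x, w x * ‖boundaryFn h x‖ ^ 2 ∂haarAddCircle : ℝ) : ℂ) := by
  rw [functional_apply]
  refine Eq.trans ?_ integral_ofReal
  congr 1; funext x
  rw [Complex.conj_mul', ← Complex.ofReal_pow]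
  exact (Complex.ofReal_mul _ _).symm

theorem IsOrthogonalityWeight.integral_norm_sq_pos {w : AddCircle (2 * Real.pi) → ℝ}
    (hw : IsOrthogonalityWeight P w) {h : hardySpace p} (hh : P h = h) (h0 : h ≠ 0) :
    0 < ∫ x, w x * ‖boundaryFn h x‖ ^ 2 ∂haarAddCircle := by
  have hae : ∀ᵐ x ∂haarAddCircle, 0 < w x * ‖boundaryFn h x‖ ^ 2 := by
    filter_upwards [hw.pos, boundaryFn_ae_ne_zero h0] with x h1 h2
    have := norm_pos_iff.2 h2
    positivity
  rw [integral_pos_iff_support_of_nonneg_ae (hae.mono fun x hx => hx.le)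
    (hw.integrable_norm_sq hh)]
  have : (haarAddCircle (T := 2 * Real.pi))
      (Function.support fun x => w x * ‖boundaryFn h x‖ ^ 2) = 1 := by
    rw [← measure_univ (μ := haarAddCircle (T := 2 * Real.pi))]
    refine measure_congr ?_
    filter_upwards [hae] with x hx
    exact propext (iff_of_true hx.ne' trivial)
  rw [this]
  exact one_pos

/-- Both weights give Hermitian forms on `Y`, and that of `w` is positive definite, hence `A` is
injective and the pencil of the two forms has an eigenvector. -/
theorem IsOrthogonalityWeight.exists_eigenvector {w w' : AddCircle (2 * Real.pi) → ℝ}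
    (hw : IsOrthogonalityWeight P w) (hw' : IsOrthogonalityWeight P w')
    {Y : Submodule ℂ (hardySpace p)} [FiniteDimensional ℂ Y] [Nontrivial Y]
    (hPY : ∀ h : Y, P h = h) :
    ∃ g : Y, g ≠ 0 ∧ ∃ c : ℂ, ∀ y : Y,
      hw'.functional (hPY g) y = c * hw.functional (hPY g) y := by
  let b := Module.finBasis ℂ Y
  let A : Y →ₗ[ℂ] (Fin (Module.finrank ℂ Y) → ℂ) :=
    LinearMap.pi fun i => hw.functional (hPY (b i)) ∘ₗ Y.subtype
  let A' : Y →ₗ[ℂ] (Fin (Module.finrank ℂ Y) → ℂ) :=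
    LinearMap.pi fun i => hw'.functional (hPY (b i)) ∘ₗ Y.subtype
  have hinj : Function.Injective A := by
    rw [← LinearMap.ker_eq_bot, LinearMap.ker_eq_bot']
    intro g hg
    have h1 : hw.functional (hPY g) ∘ₗ Y.subtype = 0 := by
      refine b.ext fun i => ?_
      have : hw.functional (hPY (b i)) g = 0 := congrFun hg i
      rw [LinearMap.comp_apply, Submodule.subtype_apply,
        ← hw.conj_functional (hPY (b i)) (hPY g), this, map_zero, LinearMap.zero_apply]
    by_contra hne
    have h2 : hw.functional (hPY g) g = 0 := LinearMap.congr_fun h1 g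
    rw [hw.functional_self] at h2
    exact (hw.integral_norm_sq_pos (hPY g) (fun h => hne (Subtype.ext h))).ne'
      (Complex.ofReal_eq_zero.1 h2)
  obtain ⟨c, g, hg0, hA⟩ := exists_apply_eq_smul_apply hinj (by simp) A'
  -- The pencil has `g` in the linear slot of the forms; moving it to the conjugate-linear slot
  -- conjugates the eigenvalue.
  refine ⟨g, hg0, conj c, fun y => ?_⟩
  have hext : hw'.functional (hPY g) ∘ₗ Y.subtype
      = conj c • (hw.functional (hPY g) ∘ₗ Y.subtype) := by
    refine b.ext fun i => ?_
    have hi : hw'.functional (hPY (b i)) g = c * hw.functional (hPY (b i)) g := congrFun hA i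
    simp only [LinearMap.comp_apply, Submodule.subtype_apply, LinearMap.smul_apply, smul_eq_mul]
    rw [← hw.conj_functional (hPY (b i)) (hPY g), ← hw'.conj_functional (hPY (b i)) (hPY g),
      hi, map_mul]
  exact LinearMap.congr_fun hext y

/-- With `k = e^{inθ} g`, `n ≥ 0`, the hypothesis kills half of the Fourier coefficients of `(w' - r
w)|g|^2`; being real, this function vanishes, and `g` is nonzero almost everywhere. -/
theorem IsOrthogonalityWeight.ae_eq_const_mul_of_functional_eq
    {w w' : AddCircle (2 * Real.pi) → ℝ}
    (hw : IsOrthogonalityWeight P w) (hw' : IsOrthogonalityWeight P w')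
    {g : hardySpace p} (hg0 : g ≠ 0) (hPg : P g = g) {r : ℝ}
    (hall : ∀ k, hw'.functional hPg k = r * hw.functional hPg k) :
    ∀ᵐ x ∂haarAddCircle, w' x = r * w x := by
  have hint : Integrable (fun x => (w' x - r * w x) * ‖boundaryFn g x‖ ^ 2) haarAddCircle := by
    refine ((hw'.integrable_norm_sq hPg).sub ((hw.integrable_norm_sq hPg).const_mul r)).congr
      (ae_of_all _ fun x => ?_)
    simp only [Pi.sub_apply]
    ring
  have hzero : ∀ n : ℕ, ∫ x, fourier (n : ℤ) x *
      (((w' x - r * w x) * ‖boundaryFn g x‖ ^ 2 : ℝ) : ℂ) ∂haarAddCircle = 0 := by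
    intro n
    obtain ⟨k, hk⟩ := exists_boundaryFn_eq_fourier_mul n g
    have h := sub_eq_zero.2 (hall k)
    rw [functional_apply, functional_apply, ← integral_const_mul,
      ← integral_sub (hw'.integrable _ _ hPg) ((hw.integrable _ _ hPg).const_mul _)] at h
    refine Eq.trans (integral_congr_ae ?_) h
    filter_upwards [hk] with x hx
    simp only [hx, Complex.ofReal_sub, Complex.ofReal_mul, Complex.ofReal_pow,
      ← Complex.conj_mul']
    ring
  filter_upwards [ae_eq_zero_of_integral_fourier_mul_ofReal hint hzero,
    boundaryFn_ae_ne_zero hg0] with x hx hgx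
  exact sub_eq_zero.1 ((mul_eq_zero.1 hx).resolve_right
    (pow_ne_zero _ (norm_ne_zero_iff.2 hgx)))

/-- An orthogonality weight is determined up to a constant factor. -/
theorem IsOrthogonalityWeight.ae_eq_const_mul {w w' : AddCircle (2 * Real.pi) → ℝ}
    (hw : IsOrthogonalityWeight P w) (hw' : IsOrthogonalityWeight P w')
    {Y : Submodule ℂ (hardySpace p)} [FiniteDimensional ℂ Y] [Nontrivial Y]
    (hY : ∀ h, h ∈ Y ↔ P h = h) (hPP : ∀ h, P (P h) = P h) :
    ∃ r : ℝ, ∀ᵐ x ∂haarAddCircle, w' x = r * w x := by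
  have hPY : ∀ h : Y, P h = h := fun h => (hY h).1 h.2
  obtain ⟨g, hgY0, c, hform⟩ := hw.exists_eigenvector hw' hPY
  have hg0 : (g : hardySpace p) ≠ 0 := fun h => hgY0 (Subtype.ext h)
  -- The eigenvalue is real, as the quotient of the two real integrals obtained for `y = g`.
  obtain ⟨r, rfl⟩ : ∃ r : ℝ, (r : ℂ) = c := by
    have h := hform g
    rw [hw.functional_self, hw'.functional_self] at h
    have hne : ((∫ x, w x * ‖boundaryFn (g : hardySpace p) x‖ ^ 2 ∂haarAddCircle : ℝ) : ℂ) ≠ 0 :=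
      Complex.ofReal_ne_zero.2 (hw.integral_norm_sq_pos (hPY g) hg0).ne'
    exact ⟨(∫ x, w' x * ‖boundaryFn (g : hardySpace p) x‖ ^ 2 ∂haarAddCircle) /
      ∫ x, w x * ‖boundaryFn (g : hardySpace p) x‖ ^ 2 ∂haarAddCircle, by
        rw [Complex.ofReal_div, h, mul_div_cancel_right₀ _ hne]⟩
  refine ⟨r, hw.ae_eq_const_mul_of_functional_eq hw' hg0 (hPY g) fun k => ?_⟩
  -- Both functionals vanish on `k - P k`, so proportionality on `Y` extends to the whole space.
  have hker : P (k - P k) = 0 := by rw [map_sub, hPP, sub_self]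
  have hz : hw.functional (hPY g) (k - P k) = 0 := hw.integral_eq_zero _ _ (hPY g) hker
  have hz' : hw'.functional (hPY g) (k - P k) = 0 := hw'.integral_eq_zero _ _ (hPY g) hker
  rw [map_sub, sub_eq_zero] at hz hz'
  rw [hz, hz']
  exact hform ⟨P k, (hY _).2 (hPP k)⟩

/-- Elements of the range of a contractive projection of finite rank have proportional moduli. -/
theorem exists_norm_sq_boundaryFn_eq_const_mul (hp : p ≠ ∞) (hp2 : p ≠ 2) (hP : ‖P‖ ≤ 1)
    {Y : Submodule ℂ (hardySpace p)} [FiniteDimensional ℂ Y] [Nontrivial Y]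
    (hY : ∀ h, h ∈ Y ↔ P h = h) (hPP : ∀ h, P (P h) = P h) :
    ∃ S : AddCircle (2 * Real.pi) → ℝ, (∀ᵐ x ∂haarAddCircle, 0 < S x) ∧
      ∀ g ∈ Y, ∃ r : ℝ, ∀ᵐ x ∂haarAddCircle, ‖boundaryFn g x‖ ^ 2 = r * S x := by
  have hq2 : p.toReal - 2 ≠ 0 := by
    intro h
    apply hp2
    rw [← ENNReal.ofReal_toReal hp, sub_eq_zero.1 h]
    simp
  let b := Module.finBasis ℂ Y
  let v : Fin (Module.finrank ℂ Y) → hardySpace p := fun i => b i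
  have hv : ∀ i, P (v i) = v i := fun i => (hY _).1 (b i).2
  have hpos : 0 < Module.finrank ℂ Y := Module.finrank_pos
  have hv0 : v ⟨0, hpos⟩ ≠ 0 := fun h => b.ne_zero _ (Subtype.ext h)
  have hspan : ∀ h, P h = h → h ∈ Submodule.span ℂ (Set.range v) := by
    intro h hh
    have h1 : Submodule.span ℂ (Set.range v) = Y := by
      have : Set.range v = Y.subtype '' Set.range b := by
        rw [← Set.range_comp]; rfl
      rw [this, Submodule.span_image, b.span_eq, Submodule.map_top, Submodule.range_subtype]
    rw [h1]
    exact (hY h).2 hh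
  have hw := isOrthogonalityWeight_norm_conjTuple hp hP hv ⟨_, hv0⟩ hspan
  have hNpos : ∀ᵐ x ∂haarAddCircle, 0 < ‖conjTuple (fun i => boundaryFn (v i)) x‖ ^ 2 := by
    filter_upwards [boundaryFn_ae_ne_zero hv0] with x hx
    rw [norm_conjTuple_sq]
    refine lt_of_lt_of_le ?_ (Finset.single_le_sum (f := fun i => ‖boundaryFn (v i) x‖ ^ 2)
      (fun i _ => by positivity) (Finset.mem_univ ⟨0, hpos⟩))
    have := norm_pos_iff.2 hx
    positivity
  refine ⟨_, hNpos, fun g hg => ?_⟩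
  -- Adjoining `g` to the basis replaces the sum of squares `S` by `S + |g|^2`.
  let v' : Option (Fin (Module.finrank ℂ Y)) → hardySpace p := fun o => o.elim g v
  have hv' : ∀ o, P (v' o) = v' o := by
    rintro (_ | i)
    · exact (hY g).1 hg
    · exact hv i
  have hspan' : ∀ h, P h = h → h ∈ Submodule.span ℂ (Set.range v') := fun h hh =>
    Submodule.span_mono (by rintro _ ⟨i, rfl⟩; exact ⟨some i, rfl⟩) (hspan h hh)
  have hw' := isOrthogonalityWeight_norm_conjTuple hp hP hv' ⟨some ⟨0, hpos⟩, hv0⟩ hspan'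
  obtain ⟨r, hr⟩ := hw.ae_eq_const_mul hw' hY hPP
  -- Solves `(S + |g|^2)^((p-2)/2) = r S^((p-2)/2)` for `|g|^2`; here `p ≠ 2` is essential.
  refine ⟨(r ^ (p.toReal - 2)⁻¹) ^ 2 - 1, ?_⟩
  filter_upwards [hr, hw.pos, hw'.pos] with x hx h1 h2
  have hr0 : 0 ≤ r := by
    rw [hx] at h2
    exact (pos_of_mul_pos_left h2 h1.le).le
  have hroot := congrArg (fun y : ℝ => y ^ (p.toReal - 2)⁻¹) hx
  rw [Real.mul_rpow hr0 h1.le, Real.rpow_rpow_inv (norm_nonneg _) hq2,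
    Real.rpow_rpow_inv (norm_nonneg _) hq2] at hroot
  have hsq := congrArg (fun y : ℝ => y ^ 2) hroot
  rw [mul_pow, norm_conjTuple_sq (fun o => boundaryFn (v' o)), Fintype.sum_option] at hsq
  have hrest : ∑ i, ‖boundaryFn (v' (some i)) x‖ ^ 2
      = ‖conjTuple (fun i => boundaryFn (v i)) x‖ ^ 2 := by
    rw [norm_conjTuple_sq]; rfl
  rw [hrest] at hsq
  have hnone : v' none = g := rfl
  rw [hnone] at hsq
  linarith

end HardySpace

/-! ### Conclusion by polarization. -/

theorem theorem3p1 (p : ℝ≥0∞) [Fact (1 ≤ p)] (hp_top : p ≠ ∞) (hp_two : p ≠ 2) :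
    ¬ ∃ Y : Submodule ℂ (hardySpace p),
        FiniteDimensional ℂ Y ∧ 2 ≤ Module.finrank ℂ Y ∧ IsOneComplemented Y := by
  rintro ⟨Y, hfin, hdim, P, hPP, hnorm, hrange⟩
  have hY : ∀ h, h ∈ Y ↔ P h = h := by
    intro h
    rw [← hrange]
    constructor
    · rintro ⟨k, rfl⟩; exact hPP k
    · intro hh; exact ⟨h, hh⟩
  have hnt : Nontrivial Y := Module.nontrivial_of_finrank_pos (R := ℂ) (by omega)
  obtain ⟨S, hS, hmod⟩ := exists_norm_sq_boundaryFn_eq_const_mul hp_top hp_two hnorm.le hY hPP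
  obtain ⟨g, hg0⟩ := exists_ne (0 : Y)
  obtain ⟨f, hf⟩ : ∃ f : Y, ∀ c : ℂ, c • g ≠ f := by
    by_contra! h
    have := finrank_le_one g h
    omega
  obtain ⟨rf, hrf⟩ := hmod f f.2
  obtain ⟨rg, hrg⟩ := hmod g g.2
  obtain ⟨r₁, hr₁⟩ := hmod _ (Y.add_mem f.2 g.2)
  obtain ⟨r₂, hr₂⟩ := hmod _ (Y.add_mem f.2 (Y.smul_mem Complex.I g.2))
  -- Polarization: `|f + g|^2` determines the real part of `f conj g` and `|f + i g|^2` its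
  -- imaginary part, so `f conj g = κ S`. Since `g conj g = rg S`, it follows that `f = (κ / rg) g`.
  let κ : ℂ := (((r₁ - rf - rg) / 2 : ℝ) : ℂ) + (((r₂ - rf - rg) / 2 : ℝ) : ℂ) * Complex.I
  have hg0' : (g : hardySpace p) ≠ 0 := fun h => hg0 (Subtype.ext h)
  refine hf (κ / rg) (Subtype.ext (boundaryFn_ext ?_))
  filter_upwards [hS, hrf, hrg, hr₁, hr₂, boundaryFn_add (f : hardySpace p) g,
    boundaryFn_add (f : hardySpace p) (Complex.I • (g : hardySpace p)),
    boundaryFn_smul Complex.I (g : hardySpace p), boundaryFn_smul (κ / rg) (g : hardySpace p),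
    boundaryFn_ae_ne_zero hg0'] with x hSx h1 h2 h3 h4 h5 h6 h7 h8 h9
  rw [Submodule.coe_smul, h8]
  rw [h5] at h3
  rw [h6, h7] at h4
  generalize boundaryFn (f : hardySpace p) x = a at *
  generalize boundaryFn (g : hardySpace p) x = b at *
  have hbb : b * (starRingEnd ℂ) b = rg * S x := by
    rw [Complex.mul_conj', ← Complex.ofReal_pow, h2, Complex.ofReal_mul]
  have hrg0 : (rg : ℂ) ≠ 0 := by
    intro h0
    rw [h0, zero_mul] at hbb
    exact (mul_ne_zero h9 ((map_ne_zero _).2 h9)) hbb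
  have hab : a * (starRingEnd ℂ) b = κ * S x := by
    simp only [← Complex.normSq_eq_norm_sq, Complex.normSq_apply, Complex.add_re, Complex.add_im,
      Complex.mul_re, Complex.mul_im, Complex.I_re, Complex.I_im] at h1 h2 h3 h4
    apply Complex.ext
    · simp [κ]
      linarith
    · simp [κ]
      linarith
  refine mul_right_cancel₀ ((map_ne_zero (starRingEnd ℂ)).2 h9) ?_
  rw [hab, mul_assoc, hbb]
  field_simp
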